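/- Conventions. For a smooth ($C^\infty$, Hausdorff, second countable) $n$-manifold $M$ let $\mathrm{Vect}(M)$ be the Lie algebra of $C^\infty$ vector fields on $M$ with its $C^\infty$ topology (uniform convergence of all derivatives on compact subsets of charts), and let $W_n=\mathrm{Vect}(\mathbb R^n)$. For $\mathfrak g=\mathrm{Vect}(M)$ or $W_n$, let $C^k_{\mathrm{Lie}}(\mathfrak g;\mathbb C)$ be the space of continuous alternating $\mathbb R$-multilinear forms $\mathfrak g^k\to\mathbb C$ ($0$ for $k<0$), with the Chevalley–Eilenberg differential $$(\delta c)(A_0,\dots,A_k)=\sum_{i<j}(-1)^{i+j}c([A_i,A_j],A_0,\dots,\widehat{A_i},\dots,\widehat{A_j},\dots,A_k).$$ Cocycles, coboundaries and classes $[\,\cdot\,]$ of cochains refer to this complex. Singular chains are finite $\mathbb C$-linear combinations of smooth singular simplices. Let $M$ be equipped with a coordinate system $\varphi_x:\mathbb R^n\to M$ (a diffeomorphism onto an open subset, $\varphi_x(0)=x$) at every point $x\in M$, smoothly depending on $x$, i.e. $(x,u)\mapsto\varphi_x(u)$ is $C^\infty$. Let $\varphi_x^*:\mathrm{Vect}(M)\to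 W_n$ be the pull-back of vector fields. A vector $v\in T_xM$ determines the vector field $t_v\in W_n$, $t_v=\frac{d}{ds}\big|_{s=0}\,\varphi_x^{-1}\circ\varphi_{x(s)}$ for any curve $x(s)$ with $x(0)=x$, $\dot x(0)=v$; that is, $t_v(u)=(d_u\varphi_x)^{-1}\big(\partial_v\,[y\mapsto\varphi_y(u)](x)\big)$. For a cochain $\xi\in C^k_{\mathrm{Lie}}(W_n;\mathbb C)$ and $0\le l\le k$ put $$\Theta_l(v_1,\dots,v_l)(A_1,\dots,A_{k-l})=\xi(t_{v_1},\dots,t_{v_l},\varphi_x^*A_1,\dots,\varphi_x^*A_{k-l}),\qquad v_i\in T_xM,\ A_j\in\mathrm{Vect}(M),$$ and for a singular $l$-chain $\sigma$ in $M$ put $\int_\sigma\xi=\int_\sigma\Theta_l$, a function of $A_1,\dots,A_{k-l}$. **Theorem 2.3.** Let $\xi\in C^k_{\mathrm{Lie}}(W_n;\mathbb C)$ be a cocycle, let $M$ and $(\varphi_x)$ be as above, and let $0\le l\le k$. For every singular $l$-cycle $\sigma$ in $M$, $\int_\sigma\xi$ is a cocycle in $C^{k-l}_{\mathrm{Lie}}(\mathrm{Vect}(M);\mathbb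 C)$, and: (1) if $\xi$ is a coboundary, then $\int_\sigma\xi$ is a coboundary for every such $M$ and every singular $l$-cycle $\sigma$ in $M$; (2) if $\sigma$ is a boundary, then $\int_\sigma\xi$ is a coboundary. -/

import Mathlib

open scoped Manifold ContDiff Bundle Topology

noncomputable section

namespace GelfandFuks

/-! ### The topological Lie algebra of smooth vector fields -/

/-- The space `ℝⁿ`. -/
abbrev Rn (n : ℕ) : Type := EuclideanSpace ℝ (Fin n)

section VectorFields

variable (n : ℕ) (M : Type*) [TopologicalSpace M] [ChartedSpace (Rn n) M] [IsManifold (𝓡 n) ∞ M]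

/-- `Vect n M` is the space of `C^∞` vector fields on the `n`-dimensional manifold `M`. -/
abbrev Vect : Type _ := ContMDiffSection (𝓡 n) (Rn n) ∞ (TangentSpace (𝓡 n) : M → Type)

/-- `W n` is the space of `C^∞` vector fields on `ℝⁿ`. -/
abbrev W : Type := Vect n (Rn n)

variable {n M}

/-- The Lie bracket of two smooth vector fields. -/
instance : Bracket (Vect n M) (Vect n M) where
  bracket X Y :=
    { toFun := VectorField.mlieBracket (𝓡 n) X Y
      contMDiff_toFun := by
        have : IsManifold (𝓡 n) (((⊤ : ℕ∞) : WithTop ℕ∞) + 1) M :=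
          inferInstanceAs (IsManifold (𝓡 n) ∞ M)
        have : IsManifold (𝓡 n) (minSmoothness ℝ 2) M := by
          rw [minSmoothness_of_isRCLikeNormedField]
          exact IsManifold.of_le (n := ∞) (WithTop.coe_le_coe.2 le_top)
        exact ContDiff.mlieBracket_vectorField (m := ⊤) (n := ⊤)
          X.contMDiff Y.contMDiff (by simp [minSmoothness_of_isRCLikeNormedField]) }

theorem lie_apply (X Y : Vect n M) (x : M) :
    ⁅X, Y⁆ x = VectorField.mlieBracket (𝓡 n) X Y x := rfl

theorem Vect.mdiffAt (X : Vect n M) (x : M) :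
    MDifferentiableAt (𝓡 n) (𝓡 n).tangent (fun y => (⟨y, X y⟩ : TangentBundle (𝓡 n) M)) x :=
  (X.contMDiff x).mdifferentiableAt (by simp)

instance : LieRing (Vect n M) where
  add_lie X Y Z := by
    ext x : 1
    exact VectorField.mlieBracket_add_left (X.mdiffAt x) (Y.mdiffAt x)
  lie_add X Y Z := by
    ext x : 1
    exact VectorField.mlieBracket_add_right (Y.mdiffAt x) (Z.mdiffAt x)
  lie_self X := by
    ext x : 1
    simp [lie_apply]
  leibniz_lie X Y Z := by
    ext x : 1
    have : IsManifold (𝓡 n) (minSmoothness ℝ 3) M := by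
      rw [minSmoothness_of_isRCLikeNormedField]
      exact IsManifold.of_le (n := ∞) (WithTop.coe_le_coe.2 le_top)
    have h : minSmoothness ℝ 2 ≤ (∞ : WithTop ℕ∞) := by
      rw [minSmoothness_of_isRCLikeNormedField]
      exact WithTop.coe_le_coe.2 le_top
    exact VectorField.leibniz_identity_mlieBracket_apply
      ((X.contMDiff x).of_le h) ((Y.contMDiff x).of_le h) ((Z.contMDiff x).of_le h)

instance : LieAlgebra ℝ (Vect n M) where
  lie_smul c X Y := by
    ext x : 1
    exact VectorField.mlieBracket_const_smul_right (Y.mdiffAt x)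

/-- The expression of a vector field `X` in the chart of `M` at `p`: the vector field on the
target of the chart (a subset of `ℝⁿ`) obtained by pulling `X` back along the inverse of the
chart. -/
def chartRep (p : M) (X : Vect n M) : Rn n → Rn n :=
  VectorField.mpullback (𝓡 n) (𝓡 n) (chartAt (Rn n) p).symm X

/-- The `C^∞` topology on vector fields: the coarsest topology such that, for every chart (of the
family `chartAt`, which covers `M`) and every `k`, the map which sends `X` to the `k`-th derivative
of the expression of `X` in the chart is continuous for the topology of uniform convergence on
compact subsets of the target of the chart. -/
instance : TopologicalSpace (Vect n M) :=
  ⨅ (p : M) (k : ℕ), TopologicalSpace.induced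
    (fun X => UniformOnFun.ofFun {K : Set (Rn n) | IsCompact K ∧ K ⊆ (chartAt (Rn n) p).target}
      (iteratedFDeriv ℝ k (chartRep p X)))
    inferInstance

end VectorFields

/-! ### Lie algebra cochains with trivial coefficients `ℂ` -/

section Cochains

variable {g : Type*}

/-- The Chevalley-Eilenberg differential
`(δ c)(A₀, …, A_k) = ∑_{i < j} (-1)^(i+j) c([A_i, A_j], A₀, …, Â_i, …, Â_j, …, A_k)`,
written for an arbitrary function `c` of `k` arguments. -/
def lieD [Bracket g g] : {k : ℕ} → ((Fin k → g) → ℂ) → (Fin (k + 1) → g) → ℂ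
  | 0, _, _ => 0
  | k + 1, c, A => ∑ j : Fin (k + 2), ∑ i : Fin (k + 1),
      if i.castSucc < j then
        (-1 : ℂ) ^ ((i : ℕ) + (j : ℕ)) *
          c (Fin.cons ⁅A i.castSucc, A j⁆ (fun r : Fin k => A (j.succAbove (i.succAbove r))))
      else 0

variable [LieRing g] [LieAlgebra ℝ g] [TopologicalSpace g]

/-- `c` is a continuous `ℂ`-valued `k`-cochain on `g`, i.e. a continuous alternating
`ℝ`-multilinear form. -/
def IsCochain {k : ℕ} (c : (Fin k → g) → ℂ) : Prop :=
  ∃ f : g [⋀^Fin k]→L[ℝ] ℂ, ∀ A, c A = f A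

/-- `c` is a `k`-cocycle of the complex of continuous cochains. -/
def IsCocycle {k : ℕ} (c : (Fin k → g) → ℂ) : Prop :=
  IsCochain c ∧ ∀ A, lieD c A = 0

/-- `c` is a `k`-coboundary of the complex of continuous cochains (which is `0` in negative
degrees). -/
def IsCoboundary : {k : ℕ} → ((Fin k → g) → ℂ) → Prop
  | 0, c => ∀ A, c A = 0
  | k + 1, c => ∃ η : (Fin k → g) → ℂ, IsCochain η ∧ ∀ A, c A = lieD η A

end Cochains

/-! ### Smooth singular chains -/

section Chains

variable (n : ℕ) (M : Type*) [TopologicalSpace M] [ChartedSpace (Rn n) M]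

/-- A smooth singular `l`-simplex of `M`: a map from the standard simplex in `ℝ^{l+1}` to `M` which
extends to a `C^∞` map on an open neighbourhood of the simplex. -/
structure SmoothSimplex (l : ℕ) where
  toFun : stdSimplex ℝ (Fin (l + 1)) → M
  smooth : ∃ (U : Set (Fin (l + 1) → ℝ)) (f : (Fin (l + 1) → ℝ) → M),
    IsOpen U ∧ stdSimplex ℝ (Fin (l + 1)) ⊆ U ∧
      ContMDiffOn 𝓘(ℝ, Fin (l + 1) → ℝ) (𝓡 n) ∞ f U ∧ ∀ t, f t.1 = toFun t

/-- Smooth singular chains with complex coefficients. -/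
abbrev Chain (l : ℕ) : Type _ := SmoothSimplex n M l →₀ ℂ

variable {n M}

/-- The `i`-th face of a smooth singular simplex. -/
def SmoothSimplex.face {l : ℕ} (s : SmoothSimplex n M (l + 1)) (i : Fin (l + 2)) :
    SmoothSimplex n M l where
  toFun t := s.toFun (stdSimplex.map i.succAbove t)
  smooth := by
    obtain ⟨U, f, hU, hs, hf, h⟩ := s.smooth
    let L : (Fin (l + 1) → ℝ) →L[ℝ] (Fin (l + 2) → ℝ) :=
      LinearMap.toContinuousLinearMap (FunOnFinite.linearMap ℝ ℝ i.succAbove)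
    refine ⟨L ⁻¹' U, f ∘ L, hU.preimage L.continuous, ?_, ?_, ?_⟩
    · intro t ht
      exact hs (stdSimplex.map i.succAbove ⟨t, ht⟩).2
    · exact hf.comp L.contDiff.contMDiff.contMDiffOn (fun _ ht => ht)
    · intro t
      exact h (stdSimplex.map i.succAbove t)

/-- The singular boundary `∂ s = ∑ i, (-1)^i (i-th face of s)`. -/
def boundary {l : ℕ} : Chain n M (l + 1) →ₗ[ℂ] Chain n M l :=
  Finsupp.linearCombination ℂ
    (fun s => ∑ i : Fin (l + 2), (-1 : ℂ) ^ (i : ℕ) • Finsupp.single (s.face i) (1 : ℂ))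

/-- Singular cycles; every `0`-chain is a cycle. -/
def IsCycle : {l : ℕ} → Chain n M l → Prop
  | 0, _ => True
  | _ + 1, σ => boundary σ = 0

/-- Singular boundaries, i.e. the cycles whose homology class vanishes. -/
def IsBoundary {l : ℕ} (σ : Chain n M l) : Prop :=
  ∃ γ : Chain n M (l + 1), boundary γ = σ

/-- The affine parametrization `(t₁, …, t_l) ↦ (1 - ∑ tᵢ, t₁, …, t_l)` of the affine hull of the
standard simplex. -/
def simplexParam (l : ℕ) (t : Fin l → ℝ) : Fin (l + 1) → ℝ :=
  Fin.cons (1 - ∑ i, t i) t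

/-- The solid simplex `{t : tᵢ ≥ 0, ∑ tᵢ ≤ 1}` in `ℝ^l`. -/
def solidSimplex (l : ℕ) : Set (Fin l → ℝ) :=
  {t | simplexParam l t ∈ stdSimplex ℝ (Fin (l + 1))}

open Classical in
/-- A singular simplex as a function of the coordinates `t₁, …, t_l`; the value outside of
`solidSimplex l` is irrelevant. -/
def SmoothSimplex.param {l : ℕ} (s : SmoothSimplex n M l) (t : Fin l → ℝ) : M :=
  if h : t ∈ solidSimplex l then s.toFun ⟨simplexParam l t, h⟩ else s.toFun (stdSimplex.vertex 0)

/-- The integral over a smooth singular simplex of a field `θ` of functions of `l` tangent vectors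
(of interest when `θ` is a complex valued differential `l`-form): the integral over the solid
simplex of the pull-back of `θ`, evaluated on the coordinate vectors. -/
def SmoothSimplex.integral {l : ℕ} (s : SmoothSimplex n M l)
    (θ : (x : M) → (Fin l → TangentSpace (𝓡 n) x) → ℂ) : ℂ :=
  ∫ t in solidSimplex l, θ (s.param t) (fun i =>
    mfderivWithin 𝓘(ℝ, Fin l → ℝ) (𝓡 n) s.param (solidSimplex l) t (Pi.single i (1 : ℝ) : Fin l → ℝ))

/-- The integral of a differential form over a smooth singular chain. -/
def Chain.integral {l : ℕ} (σ : Chain n M l)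
    (θ : (x : M) → (Fin l → TangentSpace (𝓡 n) x) → ℂ) : ℂ :=
  σ.sum (fun s a => a * s.integral θ)

end Chains

/-! ### Smooth families of coordinate systems, and the integral of a cochain -/

section Integration

variable (n : ℕ) (M : Type*) [TopologicalSpace M] [ChartedSpace (Rn n) M] [IsManifold (𝓡 n) ∞ M]

/-- A choice of a coordinate system `φ x : ℝⁿ → M` (a diffeomorphism onto an open subset of `M`,
with `φ x 0 = x`) at every point `x` of `M`, smoothly depending on the point. -/
structure CoordFamily where
  toFun : M → Rn n → M
  smooth : ContMDiff ((𝓡 n).prod (𝓡 n)) (𝓡 n) ∞ (Function.uncurry toFun)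
  map_zero : ∀ x, toFun x 0 = x
  injective : ∀ x, Function.Injective (toFun x)
  isLocalDiffeomorph : ∀ x, IsLocalDiffeomorph (𝓡 n) (𝓡 n) ∞ (toFun x)

variable {n M}

namespace CoordFamily

variable (φ : CoordFamily n M)

theorem isInvertible_mfderiv (x : M) (u : Rn n) :
    (mfderiv (𝓡 n) (𝓡 n) (φ.toFun x) u).IsInvertible :=
  ⟨(φ.isLocalDiffeomorph x).mfderivToContinuousLinearEquiv (by simp) u, rfl⟩

theorem contMDiff_toFun (x : M) : ContMDiff (𝓡 n) (𝓡 n) ∞ (φ.toFun x) :=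
  φ.smooth.comp (contMDiff_const.prodMk contMDiff_id)

/-- The map `Vect(M) → W_n` induced by the coordinate system at `x`: the pull-back of vector
fields along `φ x`. -/
def pull (x : M) (A : Vect n M) : W n where
  toFun := VectorField.mpullback (𝓡 n) (𝓡 n) (φ.toFun x) A
  contMDiff_toFun :=
    ContMDiff.mpullback_vectorField (n := ∞) A.contMDiff (φ.contMDiff_toFun x)
      (φ.isInvertible_mfderiv x) (by simp)

/-- The vector field `t_v` on `ℝⁿ` determined by a tangent vector `v` at `x`: if `x(s)` is a curve
in `M` with `x(0) = x` and velocity `v` at `s = 0`, then `t_v` is the derivative at `s = 0` of the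
family of local diffeomorphisms `(φ x)⁻¹ ∘ φ (x(s))` of `ℝⁿ`. Thus `t_v(u)` is the image
under the inverse of the differential of `φ x` at `u` of the derivative of `y ↦ φ y u` at `x` in
the direction `v`. -/
def t (x : M) (v : TangentSpace (𝓡 n) x) : W n where
  toFun u := (mfderiv (𝓡 n) (𝓡 n) (φ.toFun x) u).inverse
    ((mfderiv (𝓡 n) (𝓡 n) (fun y => φ.toFun y u) x :
      TangentSpace (𝓡 n) x →L[ℝ] TangentSpace (𝓡 n) (φ.toFun x u)) v)
  contMDiff_toFun := by
    intro u₀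
    have hf : ContMDiffAt ((𝓡 n).prod (𝓡 n)) (𝓡 n) ∞
        (Function.uncurry fun u y => φ.toFun y u) (u₀, x) :=
      (φ.smooth.comp (contMDiff_snd.prodMk contMDiff_fst)) (u₀, x)
    have h1 := ContMDiffAt.mfderiv (m := ∞) (fun u y => φ.toFun y u) (fun _ => x) hf
      contMDiffAt_const (by simp)
    have hc : ContMDiffAt (𝓡 n) (𝓡 n).tangent ∞
        (fun _ : Rn n => (⟨x, v⟩ : TangentBundle (𝓡 n) M)) u₀ := contMDiffAt_const
    have hv : ContMDiffAt (𝓡 n) (𝓡 n).tangent ∞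
        (fun u => (⟨φ.toFun x u, (mfderiv (𝓡 n) (𝓡 n) (fun y => φ.toFun y u) x :
          TangentSpace (𝓡 n) x →L[ℝ] TangentSpace (𝓡 n) (φ.toFun x u)) v⟩ :
            TangentBundle (𝓡 n) M)) u₀ :=
      ContMDiffAt.clm_apply_of_inCoordinates (b₁ := fun _ => x) (b₂ := φ.toFun x)
        (v := fun _ => v)
        (ϕ := fun u => (mfderiv (𝓡 n) (𝓡 n) (fun y => φ.toFun y u) x :
          TangentSpace (𝓡 n) x →L[ℝ] TangentSpace (𝓡 n) (φ.toFun x u)))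
        h1 hc (φ.contMDiff_toFun x u₀)
    have h2 : ContMDiffAt (𝓡 n) 𝓘(ℝ, Rn n →L[ℝ] Rn n) ∞
        (fun u => ContinuousLinearMap.inCoordinates (Rn n)
          (TangentSpace (𝓡 n) (M := Rn n)) (Rn n) (TangentSpace (𝓡 n) (M := M))
          u₀ u (φ.toFun x u₀) (φ.toFun x u) (mfderiv (𝓡 n) (𝓡 n) (φ.toFun x) u)) u₀ :=
      (φ.contMDiff_toFun x u₀).mfderiv_const (by simp)
    have h3 : ContMDiffAt (𝓡 n) 𝓘(ℝ, Rn n →L[ℝ] Rn n) ∞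
        (ContinuousLinearMap.inverse ∘ fun u => ContinuousLinearMap.inCoordinates (Rn n)
          (TangentSpace (𝓡 n) (M := Rn n)) (Rn n) (TangentSpace (𝓡 n) (M := M))
          u₀ u (φ.toFun x u₀) (φ.toFun x u) (mfderiv (𝓡 n) (𝓡 n) (φ.toFun x) u)) u₀ := by
      apply ContMDiffAt.comp _ _ h2
      apply ContDiffAt.contMDiffAt
      apply ContinuousLinearMap.IsInvertible.contDiffAt_map_inverse
      rw [ContinuousLinearMap.inCoordinates_eq (FiberBundle.mem_baseSet_trivializationAt' u₀)
        (FiberBundle.mem_baseSet_trivializationAt' (φ.toFun x u₀))]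
      exact ContinuousLinearMap.isInvertible_equiv.comp
        ((φ.isInvertible_mfderiv x u₀).comp ContinuousLinearMap.isInvertible_equiv)
    refine ContMDiffAt.clm_apply_of_inCoordinates (b₁ := φ.toFun x) (b₂ := fun u => u)
      (v := fun u => (mfderiv (𝓡 n) (𝓡 n) (fun y => φ.toFun y u) x :
          TangentSpace (𝓡 n) x →L[ℝ] TangentSpace (𝓡 n) (φ.toFun x u)) v)
      (ϕ := fun u => (mfderiv (𝓡 n) (𝓡 n) (φ.toFun x) u).inverse)
      (h3.congr_of_eventuallyEq ?_) hv contMDiffAt_id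
    have A : (trivializationAt (Rn n) (TangentSpace (𝓡 n)) u₀).baseSet ∈ 𝓝 u₀ :=
      (trivializationAt _ _ _).open_baseSet.mem_nhds (FiberBundle.mem_baseSet_trivializationAt' _)
    have B : φ.toFun x ⁻¹' (trivializationAt (Rn n) (TangentSpace (𝓡 n) (M := M))
        (φ.toFun x u₀)).baseSet ∈ 𝓝 u₀ :=
      (φ.contMDiff_toFun x).continuous.continuousAt.preimage_mem_nhds
        ((trivializationAt _ _ _).open_baseSet.mem_nhds
          (FiberBundle.mem_baseSet_trivializationAt' _))
    filter_upwards [A, B] with u hu hu'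
    simp only [Function.comp_apply]
    rw [ContinuousLinearMap.inCoordinates_eq hu hu',
      ContinuousLinearMap.inCoordinates_eq hu' (by exact hu)]
    simp only [ContinuousLinearMap.inverse_equiv_comp, ContinuousLinearMap.inverse_comp_equiv,
      ContinuousLinearEquiv.symm_symm]
    rfl

end CoordFamily

/-- The canonical form `Θ_l ∈ Ω^l(M) ⊗ C^m(Vect(M))` of a cochain `ξ` on `W_n`:
`Θ_l(v₁, …, v_l)(A₁, …, A_m) = ξ(t_{v₁}, …, t_{v_l}, (φ x)^* A₁, …, (φ x)^* A_m)` at the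
point `x`. -/
def Theta (φ : CoordFamily n M) {l m : ℕ} (ξ : (Fin (l + m) → W n) → ℂ) (A : Fin m → Vect n M)
    (x : M) (v : Fin l → TangentSpace (𝓡 n) x) : ℂ :=
  ξ (Fin.append (fun i => φ.t x (v i)) (fun j => φ.pull x (A j)))

/-- The integral `∫_σ ξ = ∫_σ Θ_l`, as a function of `m` vector fields on `M`. -/
def integral (φ : CoordFamily n M) {l m : ℕ} (σ : Chain n M l) (ξ : (Fin (l + m) → W n) → ℂ)
    (A : Fin m → Vect n M) : ℂ :=
  Chain.integral σ (Theta φ ξ A)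

end Integration

end GelfandFuks

end

/-! Let `F` be a smooth map from a parameter space `P` to `M`, and let Φ(t,u) = φ_{F(t)}(u), a map
from `P × ℝⁿ` to `M`. Two identities carry the proof: ∂_w(φ^*A) = [t_w, φ^*A] (`deriv_pull`), and
the Maurer–Cartan equation ∂_w t_{w'} − ∂_{w'} t_w = [t_w, t_{w'}] (`deriv_along_sub_deriv_along`).
They hold because the field (w, −t_w) on `P × ℝⁿ` is Φ-related to 0 and (0, φ^*A) is Φ-related to A.
Brackets of related fields are related, and dΦ is injective along the fibres `ℝⁿ`.

Let c be a cochain and differentiate the form Θ of c by the product rule (`hasDerivAt_cochain`). By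
the two identities, the exterior derivative produces minus those terms of δc in which the bracket
involves at least one t_v (`sum_update_add_lieD`). The remaining terms of δc, with brackets of two
pulled-back fields, form up to sign the differential on Vect(M) (`lieDTail_append`), since pull-back
respects brackets. With Stokes' theorem (`stokes_solidSimplex`) this gives, for a (p+1)-chain γ,
∫_{∂γ} c = (−1)^{p+1} δ(∫_γ c) − ∫_γ δc (`integral_boundary_succ`); the δ(∫_γ c) term is absent when
no vector fields on `M` remain as arguments (`integral_boundary_zero`).

The rest is formal. On an l-cycle σ, δ∫_σ c = (−1)^l ∫_σ δc, so integration takes cocycles to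
cocycles and coboundaries to coboundaries. If δξ = 0 and σ = ∂γ, then ∫_σ ξ is ±δ∫_γ ξ, or 0 in
degree 0.

The analytic work comes from the C^∞ topology, for which cochains are merely continuous. Difference
quotients of smooth families must converge in it, and pull-back must be continuous jointly in the
point and the field. Both are obtained from `FamilyCk`. -/

noncomputable section

namespace GelfandFuks

/-! ### Antisymmetrized derivatives of an alternating form -/

section Algebra

variable {V : Type*} [AddCommGroup V] [Module ℝ V]

/-- The pair (a, c) encodes the ordered pair of distinct indices a and `a.succAbove c`. The two
orderings of the same pair i < j are collected: removing j first leaves the other index at position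
i, removing i first leaves it at position `predAbove i j`. -/
theorem sum_sum_succAbove {k : ℕ} {N : Type*} [AddCommGroup N]
    (g : Fin (k + 2) → Fin (k + 1) → N) :
    ∑ a, ∑ c, g a c = ∑ j : Fin (k + 2), ∑ i : Fin (k + 1),
      if i.castSucc < j then g j i + g i.castSucc (Fin.predAbove i j) else 0 := by
  have h1 : ∑ a : Fin (k + 2), ∑ c : Fin (k + 1), g a c =
      (∑ a : Fin (k + 2), ∑ c : Fin (k + 1), if c.castSucc < a then g a c else 0) +
      ∑ a : Fin (k + 2), ∑ c : Fin (k + 1), if c.castSucc < a then 0 else g a c := by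
    rw [← Finset.sum_add_distrib]
    refine Finset.sum_congr rfl fun a _ => ?_
    rw [← Finset.sum_add_distrib]
    refine Finset.sum_congr rfl fun c _ => ?_
    split_ifs <;> simp
  have h2 : (∑ a : Fin (k + 2), ∑ c : Fin (k + 1), if c.castSucc < a then 0 else g a c) =
      ∑ a : Fin (k + 2), ∑ c : Fin (k + 1),
        if c.castSucc < a then g c.castSucc (Fin.predAbove c a) else 0 := by
    rw [Finset.sum_comm (f := fun (a : Fin (k + 2)) (c : Fin (k + 1)) =>
      if c.castSucc < a then g c.castSucc (Fin.predAbove c a) else 0)]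
    rw [Fin.sum_univ_castSucc]
    have hz : ∀ c : Fin (k + 1),
        (if c.castSucc < Fin.last (k + 1) then 0 else g (Fin.last (k + 1)) c) = 0 := by
      intro c; simp [Fin.castSucc_lt_last]
    simp only [hz, Finset.sum_const_zero, add_zero]
    refine Finset.sum_congr rfl fun c _ => ?_
    rw [Fin.sum_univ_succ (n := k + 1)]
    simp only [Fin.not_lt_zero, if_false, zero_add]
    refine Finset.sum_congr rfl fun a _ => ?_
    by_cases h : a < c
    · have h' : ¬ c.castSucc < a.succ := by
        simp only [Fin.lt_def, Fin.val_castSucc, Fin.val_succ] at *; omega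
      rw [if_pos (by simpa using h), if_neg h']
    · have h' : c.castSucc < a.succ := by
        simp only [Fin.lt_def, Fin.val_castSucc, Fin.val_succ] at *; omega
      rw [if_neg (by simpa using h), if_pos h', Fin.predAbove_of_castSucc_lt _ _ h']
      simp
  rw [h1, h2, ← Finset.sum_add_distrib]
  refine Finset.sum_congr rfl fun a _ => ?_
  rw [← Finset.sum_add_distrib]
  refine Finset.sum_congr rfl fun c _ => ?_
  split_ifs <;> simp

theorem map_update_eq_cons {k : ℕ} (c : V [⋀^Fin (k + 1)]→ₗ[ℝ] ℂ) (v : Fin (k + 1) → V)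
    (i : Fin (k + 1)) (x : V) :
    c (Function.update v i x) =
      (-1 : ℂ) ^ (i : ℕ) * c (Fin.cons x (fun r => v (i.succAbove r)) : Fin (k + 1) → V) := by
  have h : Function.update v i x = i.insertNth x (fun r => v (i.succAbove r)) := by
    have := Fin.insertNth_removeNth i x v
    rw [← this]; rfl
  rw [h, AlternatingMap.map_insertNth]
  have h2 : ((-1 : ℤ) ^ (i : ℕ)) • c (Matrix.vecCons x (fun r => v (i.succAbove r))) =
    (-1 : ℂ) ^ (i : ℕ) * c (Fin.cons x (fun r => v (i.succAbove r)) : Fin (k + 1) → V) := by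
      simp [Matrix.vecCons]
  rw [← h2]

/-- The alternating sum of the derivatives of an alternating form, in terms of the
antisymmetrization of the matrix `E a b` of the derivatives of the arguments. -/
theorem sum_update_eq {k : ℕ} (c : V [⋀^Fin (k + 1)]→ₗ[ℝ] ℂ) (B : Fin (k + 2) → V)
    (E : Fin (k + 2) → Fin (k + 2) → V) :
    ∑ a : Fin (k + 2), (-1 : ℂ) ^ (a : ℕ) * ∑ i : Fin (k + 1),
        c (Function.update (fun r => B (a.succAbove r)) i (E a (a.succAbove i))) =
      ∑ j : Fin (k + 2), ∑ i : Fin (k + 1), if i.castSucc < j then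
        (-1 : ℂ) ^ ((i : ℕ) + (j : ℕ)) *
          c (Fin.cons (E j i.castSucc - E i.castSucc j)
            (fun r : Fin k => B (j.succAbove (i.succAbove r)))) else 0 := by
  simp only [Finset.mul_sum]
  rw [sum_sum_succAbove]
  refine Finset.sum_congr rfl fun j _ => Finset.sum_congr rfl fun i _ => ?_
  split_ifs with h
  swap
  · rfl
  obtain ⟨j, rfl⟩ : ∃ j' : Fin (k + 1), j = j'.succ := ⟨j.pred (Fin.ne_zero_of_lt h), by simp⟩
  have hle : i ≤ j := by
    simp only [Fin.lt_def, Fin.le_def, Fin.val_castSucc, Fin.val_succ] at *; omega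
  have e1 : j.succ.succAbove i = i.castSucc := Fin.succAbove_of_castSucc_lt _ _ h
  have e2 : Fin.predAbove i j.succ = j := by
    rw [Fin.predAbove_of_castSucc_lt _ _ h]; simp
  have e3 : i.castSucc.succAbove j = j.succ := by simp [Fin.succAbove_of_le_castSucc, hle]
  have e4 : (fun r : Fin k => B (i.castSucc.succAbove (j.succAbove r))) =
      fun r => B (j.succ.succAbove (i.succAbove r)) := by
    funext r
    have := Fin.succAbove_succAbove_succAbove_predAbove i.castSucc j r
    rw [e3, Fin.predAbove_castSucc_of_le _ _ hle] at this
    rw [this]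
  rw [e2, map_update_eq_cons, map_update_eq_cons, e1, e3, e4]
  have e5 : c (Fin.cons (E j.succ i.castSucc - E i.castSucc j.succ)
      (fun r : Fin k => B (j.succ.succAbove (i.succAbove r)))) =
      c (Fin.cons (E j.succ i.castSucc) (fun r : Fin k => B (j.succ.succAbove (i.succAbove r)))) -
      c (Fin.cons (E i.castSucc j.succ)
        (fun r : Fin k => B (j.succ.succAbove (i.succAbove r)))) := by
    have := c.toMultilinearMap.cons_add (fun r : Fin k => B (j.succ.succAbove (i.succAbove r)))
      (E j.succ i.castSucc - E i.castSucc j.succ) (E i.castSucc j.succ)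
    rw [sub_add_cancel] at this
    exact eq_sub_of_add_eq this.symm
  rw [e5]
  simp only [Fin.val_castSucc, Fin.val_succ, pow_add, pow_one]
  ring

end Algebra

/-! ### Splitting the Chevalley–Eilenberg differential by the type of bracket -/

section LieAlgebra

variable {V : Type*} [LieRing V] [LieAlgebra ℝ V]

/-- The part of the Chevalley-Eilenberg differential which involves the brackets of the
arguments with indices at least `L`. -/
def lieDTail (L : ℕ) : {k : ℕ} → ((Fin k → V) → ℂ) → (Fin (k + 1) → V) → ℂ
  | 0, _, _ => 0
  | k + 1, c, A => ∑ j : Fin (k + 2), ∑ i : Fin (k + 1),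
      if i.castSucc < j then
        if L ≤ (i : ℕ) then
          (-1 : ℂ) ^ ((i : ℕ) + (j : ℕ)) *
            c (Fin.cons ⁅A i.castSucc, A j⁆ (fun r : Fin k => A (j.succAbove (i.succAbove r))))
        else 0
      else 0

/-- Here `E a b` stands for the derivative of argument b in the direction attached to argument a;
only the indices below `L` have a direction. A pair with smaller index below `L` contributes `E j i
- E i j`, which is minus the bracket and hence minus a term of `lieD`. Pairs with both indices at
least `L` contribute nothing, and `lieDTail` compensates for their presence in `lieD`. -/
theorem sum_update_add_lieD {k : ℕ} (L : ℕ) (c : V [⋀^Fin k]→ₗ[ℝ] ℂ) (B : Fin (k + 1) → V)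
    (E : Fin (k + 1) → Fin (k + 1) → V)
    (hE : ∀ i j : Fin (k + 1), i < j → (i : ℕ) < L → E i j - E j i = ⁅B i, B j⁆)
    (hE0 : ∀ i j : Fin (k + 1), L ≤ (i : ℕ) → L ≤ (j : ℕ) → E i j = 0) :
    ∑ a : Fin (k + 1), (-1 : ℂ) ^ (a : ℕ) * ∑ i : Fin k,
        c (Function.update (fun r => B (a.succAbove r)) i (E a (a.succAbove i))) =
      lieDTail L c B - lieD c B := by
  cases k with
  | zero => simp [lieD, lieDTail]
  | succ k =>
    have hneg : ∀ (x : V) (v : Fin k → V), c (Fin.cons (-x) v : Fin (k + 1) → V) =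
        - c (Fin.cons x v : Fin (k + 1) → V) := by
      intro x v
      have := c.toMultilinearMap.cons_smul v (-1 : ℝ) x
      simpa using this
    have hzero : ∀ (v : Fin k → V), c (Fin.cons 0 v : Fin (k + 1) → V) = 0 := by
      intro v
      have := c.toMultilinearMap.cons_smul v (0 : ℝ) 0
      simpa using this
    rw [sum_update_eq]
    simp only [lieD, lieDTail]
    rw [← Finset.sum_sub_distrib]
    refine Finset.sum_congr rfl fun j _ => ?_
    rw [← Finset.sum_sub_distrib]
    refine Finset.sum_congr rfl fun i _ => ?_
    split_ifs with h h'
    · rw [sub_self, hE0 _ _ _ h', hE0 _ _ h' _, sub_zero, hzero, mul_zero] <;>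
      · simp only [Fin.lt_def, Fin.val_castSucc] at h; omega
    · rw [← neg_sub, hE _ _ h (by simpa using h'), hneg]; ring
    · simp

theorem append_comp_natAdd_succAbove {α : Type*} {l m : ℕ} (T : Fin l → α) (A : Fin (m + 1) → α)
    (j : Fin (m + 1)) :
    (fun r : Fin (l + m) => Fin.append T A
      ((Fin.natAdd l j : Fin (l + m + 1)).succAbove r)) =
      Fin.append T (fun r => A (j.succAbove r)) := by
  funext r
  refine Fin.addCases (fun i => ?_) (fun i => ?_) r
  · rw [Fin.append_left]
    have : (Fin.natAdd l j : Fin (l + m + 1)).succAbove (Fin.castAdd m i) =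
        (Fin.castAdd (m + 1) i : Fin (l + (m + 1))) := by
      rw [Fin.succAbove_of_castSucc_lt]
      · rfl
      · simp only [Fin.lt_def, Fin.val_castSucc, Fin.val_castAdd, Fin.val_natAdd]; omega
    rw [this]
    exact Fin.append_left T A i
  · rw [Fin.append_right]
    have : (Fin.natAdd l j : Fin (l + m + 1)).succAbove (Fin.natAdd l i) =
        (Fin.natAdd l (j.succAbove i) : Fin (l + (m + 1))) := by
      ext
      simp only [Fin.succAbove, Fin.lt_def, Fin.val_castSucc, Fin.val_natAdd]
      split_ifs <;> simp_all <;> omega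
    rw [this]
    exact Fin.append_right T A _

theorem append_comp_castAdd_succAbove {α : Type*} {l m K : ℕ} (T : Fin (l + 1) → α) (A : Fin m → α)
    (h : K + 1 = l + 1 + m) (h' : l + m = K) (a : Fin (l + 1)) :
    (fun r : Fin K => Fin.append T A (Fin.cast h ((Fin.cast h.symm (Fin.castAdd m a)).succAbove r))) =
      Fin.append (fun r => T (a.succAbove r)) A ∘ Fin.cast h'.symm := by
  subst h'
  funext r
  refine Fin.addCases (fun i => ?_) (fun i => ?_) r
  · simp only [Function.comp_apply, Fin.cast_eq_self, Fin.append_left]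
    have : Fin.cast h ((Fin.cast h.symm (Fin.castAdd m a)).succAbove (Fin.castAdd m i)) =
        Fin.castAdd m (a.succAbove i) := by
      ext
      simp only [Fin.succAbove, Fin.lt_def, Fin.val_castSucc, Fin.val_castAdd, Fin.val_cast]
      split_ifs <;> simp_all
    rw [this, Fin.append_left]
  · simp only [Function.comp_apply, Fin.cast_eq_self, Fin.append_right]
    have : Fin.cast h ((Fin.cast h.symm (Fin.castAdd m a)).succAbove (Fin.natAdd l i)) =
        Fin.natAdd (l + 1) i := by
      rw [Fin.succAbove_of_le_castSucc]
      · ext; simp; omega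
      · simp only [Fin.le_def, Fin.val_castSucc, Fin.val_castAdd, Fin.val_cast, Fin.val_natAdd]
        omega
    rw [this, Fin.append_right]

theorem map_cons_append {l m : ℕ} (c : V [⋀^Fin (l + (m + 1))]→ₗ[ℝ] ℂ) (T : Fin l → V)
    (A : Fin m → V) (x : V) :
    c (Fin.cons x (fun r => Fin.append T A r) : Fin (l + m + 1) → V) =
      (-1 : ℂ) ^ l * c (Fin.append T (Fin.cons x A : Fin (m + 1) → V)) := by
  have h := map_update_eq_cons (k := l + m) c
    (fun r => Fin.append T (Fin.cons x A : Fin (m + 1) → V) r) (Fin.natAdd l (0 : Fin (m + 1))) x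
  rw [append_comp_natAdd_succAbove] at h
  have h0 : Function.update (Fin.append T (Fin.cons x A : Fin (m + 1) → V))
      (Fin.natAdd l (0 : Fin (m + 1))) x = Fin.append T (Fin.cons x A : Fin (m + 1) → V) := by
    apply Function.update_eq_self_iff.2
    rw [Fin.append_right]; rfl
  erw [h0] at h
  rw [h]
  simp only [Fin.cons_succ, Fin.succAbove_zero, Fin.val_natAdd, Fin.val_zero, add_zero]
  rw [← mul_assoc, ← pow_add, Even.neg_one_pow ⟨l, rfl⟩, one_mul]

/-- The surviving brackets involve only entries of `A`. In `lieDTail` the bracket stands in front of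
all of `T`, on the right-hand side behind it, which costs `l` transpositions. The shift of both
indices by `l` does not affect the sign. -/
theorem lieDTail_append {l m : ℕ} (c : V [⋀^Fin (l + m)]→ₗ[ℝ] ℂ) (T : Fin l → V)
    (A : Fin (m + 1) → V) :
    lieDTail l c (fun r : Fin (l + m + 1) => Fin.append T A r) =
      (-1 : ℂ) ^ l * lieD (fun A' : Fin m → V => c (Fin.append T A')) A := by
  cases m with
  | zero =>
    -- A single entry of `A` leaves no pair to bracket, so both sides vanish.
    simp only [lieD, mul_zero]
    cases l with
    | zero => rfl
    | succ l =>
      refine Finset.sum_eq_zero fun j _ => Finset.sum_eq_zero fun i _ => ?_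
      have := i.2
      have h' : ¬ (l + 1 ≤ (i : ℕ)) := by omega
      rw [if_neg h', ite_self]
  | succ m =>
    simp only [lieD]
    change ∑ j : Fin (l + (m + 2)), ∑ i : Fin (l + (m + 1)), _ = _
    rw [Fin.sum_univ_add]
    have h1 : ∑ j : Fin l, ∑ i : Fin (l + (m + 1)),
      (if i.castSucc < (Fin.castAdd (m + 2) j : Fin (l + m + 2)) then
        if l ≤ (i : ℕ) then
          (-1 : ℂ) ^ ((i : ℕ) + ((Fin.castAdd (m + 2) j : Fin (l + m + 2)) : ℕ)) *
            c (Fin.cons ⁅Fin.append T A i.castSucc,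
              Fin.append T A (Fin.castAdd (m + 2) j : Fin (l + m + 2))⁆
              (fun r : Fin (l + m) => Fin.append T A
                ((Fin.castAdd (m + 2) j : Fin (l + m + 2)).succAbove (i.succAbove r))))
        else 0
      else 0) = 0 := by
      refine Finset.sum_eq_zero fun j _ => Finset.sum_eq_zero fun i _ => ?_
      split_ifs with h h'
      · exfalso
        simp only [Fin.lt_def, Fin.val_castSucc, Fin.val_castAdd] at h
        omega
      · rfl
      · rfl
    erw [h1]
    rw [zero_add, Finset.mul_sum]
    refine Finset.sum_congr rfl fun j _ => ?_
    rw [Fin.sum_univ_add, Finset.mul_sum]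
    rw [Finset.sum_eq_zero, zero_add]
    swap
    · intro i _
      have h' : ¬ (l ≤ ((Fin.castAdd (m + 1) i : Fin (l + (m + 1))) : ℕ)) := by simp
      rw [if_neg h', ite_self]
    refine Finset.sum_congr rfl fun i _ => ?_
    have hlt : ((Fin.natAdd l i).castSucc < Fin.natAdd l j) ↔ i.castSucc < j := by
      simp [Fin.lt_def]
    by_cases h : i.castSucc < j
    · rw [if_pos (hlt.2 h), if_pos (by simp), if_pos h]
      have e1 := append_comp_natAdd_succAbove T A j
      have e2 := append_comp_natAdd_succAbove T (fun r => A (j.succAbove r)) i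
      have e3 : (fun r : Fin (l + m) => Fin.append T A
          ((Fin.natAdd l j : Fin (l + m + 2)).succAbove
            ((Fin.natAdd l i : Fin (l + m + 1)).succAbove r))) =
          Fin.append T (fun r => A (j.succAbove (i.succAbove r))) := by
        rw [← e2]
        funext r
        exact congrFun e1 _
      erw [e3, map_cons_append]
      have e4 : Fin.append T A (Fin.natAdd l j) = A j := Fin.append_right _ _ _
      have e5 : Fin.append T A ((Fin.natAdd l i).castSucc : Fin (l + (m + 1) + 1)) =
          A i.castSucc := Fin.append_right _ _ i.castSucc
      beta_reduce
      erw [e4, e5]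
      simp only [Fin.val_natAdd]
      have : (-1 : ℂ) ^ (l + (i : ℕ) + (l + (j : ℕ))) = (-1) ^ ((i : ℕ) + (j : ℕ)) := by
        rw [show l + (i : ℕ) + (l + (j : ℕ)) = (l + l) + ((i : ℕ) + (j : ℕ)) by ring, pow_add,
          Even.neg_one_pow ⟨l, rfl⟩, one_mul]
      rw [this]; ring
    · rw [if_neg (fun h' => h (hlt.1 h')), if_neg h, mul_zero]

end LieAlgebra

/-! ### Functions with derivatives jointly continuous in a parameter and the point -/

section ParametricSmoothness

variable {X : Type*} [TopologicalSpace X]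
  {E : Type} [NormedAddCommGroup E] [NormedSpace ℝ E]

/-- `FamilyCk S k f`: on the open set `S`, the family of functions `f x : E → F` is `k` times
differentiable, with derivatives which depend continuously on both the parameter and the
point. -/
def FamilyCk (S : Set (X × E)) : (k : ℕ) → {F : Type} → [NormedAddCommGroup F] →
    [NormedSpace ℝ F] → (X → E → F) → Prop
  | 0, _, _, _, f => ContinuousOn (fun p : X × E => f p.1 p.2) S
  | k + 1, F, _, _, f => ContinuousOn (fun p : X × E => f p.1 p.2) S ∧
      ∃ f' : X → E → E →L[ℝ] F, (∀ p ∈ S, HasFDerivAt (f p.1) (f' p.1 p.2) p.2) ∧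
        FamilyCk S k f'

variable {F G H : Type} [NormedAddCommGroup F] [NormedSpace ℝ F]
  [NormedAddCommGroup G] [NormedSpace ℝ G] [NormedAddCommGroup H] [NormedSpace ℝ H]
  {S : Set (X × E)} {k : ℕ}

namespace FamilyCk

theorem continuousOn {f : X → E → F} (h : FamilyCk S k f) :
    ContinuousOn (fun p : X × E => f p.1 p.2) S := by
  cases k with
  | zero => exact h
  | succ k => exact h.1

theorem of_succ {f : X → E → F} (h : FamilyCk S (k + 1) f) : FamilyCk S k f := by
  induction k generalizing F with
  | zero => exact h.1
  | succ k ih =>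
    obtain ⟨h0, f', h1, h2⟩ := h
    exact ⟨h0, f', h1, ih h2⟩

theorem eventually_mem (hS : IsOpen S) {p : X × E} (hp : p ∈ S) :
    ∀ᶠ u in 𝓝 p.2, (p.1, u) ∈ S :=
  (hS.preimage (Continuous.prodMk_right p.1)).mem_nhds hp

theorem congr (hS : IsOpen S) {f g : X → E → F} (h : FamilyCk S k f)
    (hfg : ∀ p ∈ S, f p.1 p.2 = g p.1 p.2) : FamilyCk S k g := by
  have hc : ContinuousOn (fun p : X × E => g p.1 p.2) S :=
    h.continuousOn.congr fun p hp => (hfg p hp).symm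
  cases k with
  | zero => exact hc
  | succ k =>
    obtain ⟨h0, f', h1, h2⟩ := h
    refine ⟨hc, f', fun p hp => (h1 p hp).congr_of_eventuallyEq ?_, h2⟩
    filter_upwards [eventually_mem hS hp] with u hu
    exact (hfg _ hu).symm

theorem continuousOn_iteratedFDeriv (hS : IsOpen S) {f : X → E → F} (h : FamilyCk S k f) :
    ContinuousOn (fun p : X × E => iteratedFDeriv ℝ k (f p.1) p.2) S := by
  induction k generalizing F with
  | zero =>
    simp only [iteratedFDeriv_zero_eq_comp, Function.comp_apply]
    exact (continuousMultilinearCurryFin0 ℝ E F).symm.continuous.comp_continuousOn h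
  | succ k ih =>
    obtain ⟨h0, f', h1, h2⟩ := h
    have h3 := (continuousMultilinearCurryRightEquiv' ℝ k E F).symm.continuous.comp_continuousOn
      (ih h2)
    refine h3.congr fun p hp => ?_
    have h4 : fderiv ℝ (f p.1) =ᶠ[𝓝 p.2] f' p.1 := by
      filter_upwards [eventually_mem hS hp] with u hu
      exact (h1 _ hu).fderiv
    rw [iteratedFDeriv_succ_eq_comp_right]
    simp only [Function.comp_apply]
    rw [(Filter.EventuallyEq.iteratedFDeriv ℝ h4 k).eq_of_nhds]

/-- The C^∞ topology is defined through `iteratedFDeriv`, whereas products and compositions are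
handled by the recursive form of `FamilyCk`; this is the passage from the first to the second. -/
theorem of_iteratedFDeriv {f : X → E → F}
    (h : ∀ p ∈ S, ContDiffAt ℝ k (f p.1) p.2)
    (hc : ∀ j ≤ k, ContinuousOn (fun p : X × E => iteratedFDeriv ℝ j (f p.1) p.2) S) :
    FamilyCk S k f := by
  have h0 : ContinuousOn (fun p : X × E => f p.1 p.2) S := by
    have := (continuousMultilinearCurryFin0 ℝ E F).continuous.comp_continuousOn (hc 0 (Nat.zero_le _))
    exact this.congr fun p hp => by simp
  induction k generalizing F with
  | zero => exact h0
  | succ k ih =>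
    have hd : ∀ j ≤ k, ContinuousOn
        (fun p : X × E => iteratedFDeriv ℝ j (fderiv ℝ (f p.1)) p.2) S := by
      intro j hj
      have := (continuousMultilinearCurryRightEquiv' ℝ j E F).continuous.comp_continuousOn
        (hc (j + 1) (by omega))
      refine this.congr fun p hp => ?_
      simp only [iteratedFDeriv_succ_eq_comp_right, Function.comp_apply,
        LinearIsometryEquiv.apply_symm_apply]
    refine ⟨h0, fun x => fderiv ℝ (f x), fun p hp =>
      ((h p hp).differentiableAt (by simp)).hasFDerivAt, ih ?_ hd ?_⟩
    · intro p hp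
      exact (h p hp).fderiv_right (by norm_cast)
    · have := (continuousMultilinearCurryFin0 ℝ E (E →L[ℝ] F)).continuous.comp_continuousOn
        (hd 0 (Nat.zero_le _))
      exact this.congr fun p hp => by simp

theorem add {f g : X → E → F} (hf : FamilyCk S k f) (hg : FamilyCk S k g) :
    FamilyCk S k (fun x u => f x u + g x u) := by
  induction k generalizing F with
  | zero => exact ContinuousOn.add hf hg
  | succ k ih =>
    obtain ⟨h0, f', h1, h2⟩ := hf
    obtain ⟨i0, g', i1, i2⟩ := hg
    exact ⟨h0.add i0, _, fun p hp => (h1 p hp).add (i1 p hp), ih h2 i2⟩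

theorem bilinear (B : F →L[ℝ] G →L[ℝ] H) {f : X → E → F} {g : X → E → G}
    (hf : FamilyCk S k f) (hg : FamilyCk S k g) :
    FamilyCk S k (fun x u => B (f x u) (g x u)) := by
  have hc : ContinuousOn (fun p : X × E => B (f p.1 p.2) (g p.1 p.2)) S :=
    (B.continuous.comp_continuousOn hf.continuousOn).clm_apply hg.continuousOn
  induction k generalizing F G H with
  | zero => exact hc
  | succ k ih =>
    have hf0 := hf.of_succ
    have hg0 := hg.of_succ
    obtain ⟨h0, f', h1, h2⟩ := hf
    obtain ⟨i0, g', i1, i2⟩ := hg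
    -- Leibniz rule. Both terms are again continuous bilinear expressions, with values in spaces of
    -- linear maps, so the induction has to run over all target spaces at once.
    refine ⟨hc, fun x u => B.precompR E (f x u) (g' x u) + B.precompL E (f' x u) (g x u),
      fun p hp => B.hasFDerivAt_of_bilinear (h1 p hp) (i1 p hp), add ?_ ?_⟩
    · exact ih (B.precompR E) hf0 i2 (((B.precompR E).continuous.comp_continuousOn
        hf0.continuousOn).clm_apply i2.continuousOn)
    · exact ih (B.precompL E) h2 hg0 (((B.precompL E).continuous.comp_continuousOn
        h2.continuousOn).clm_apply hg0.continuousOn)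

theorem of_contDiffOn {P : Type} [NormedAddCommGroup P] [NormedSpace ℝ P] {S : Set (P × E)}
    (hS : IsOpen S) {f : P × E → F} (hf : ContDiffOn ℝ ∞ f S) (k : ℕ) :
    FamilyCk S k (fun x u => f (x, u)) := by
  induction k generalizing F with
  | zero => exact hf.continuousOn
  | succ k ih =>
    refine ⟨hf.continuousOn,
      fun x u => (fderiv ℝ f (x, u)).comp (ContinuousLinearMap.inr ℝ P E), fun p hp => ?_, ?_⟩
    · have hd : HasFDerivAt f (fderiv ℝ f (p.1, p.2)) (p.1, p.2) :=
        ((hf.contDiffAt (hS.mem_nhds hp)).differentiableAt (by simp)).hasFDerivAt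
      exact hd.comp p.2 (hasFDerivAt_prodMk_right p.1 p.2)
    · have h1 : ContDiffOn ℝ ∞ (fderiv ℝ f) S := hf.fderiv_of_isOpen hS (by simp)
      exact ih (f := fun q => (fderiv ℝ f q).comp (ContinuousLinearMap.inr ℝ P E))
        (h1.clm_comp contDiffOn_const)

theorem comp_param {Y : Type*} [TopologicalSpace Y] {ρ : Y → X} (hρ : Continuous ρ)
    {f : X → E → F} (h : FamilyCk S k f) :
    FamilyCk {q : Y × E | (ρ q.1, q.2) ∈ S} k (fun y => f (ρ y)) := by
  have hm : Continuous fun q : Y × E => (ρ q.1, q.2) := by fun_prop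
  induction k generalizing F with
  | zero => exact ContinuousOn.comp h hm.continuousOn fun q hq => hq
  | succ k ih =>
    obtain ⟨h0, f', h1, h2⟩ := h
    exact ⟨h0.comp hm.continuousOn fun q hq => hq, fun y => f' (ρ y), fun q hq => h1 _ hq, ih h2⟩

theorem comp {D : Type} [NormedAddCommGroup D] [NormedSpace ℝ D] {T : Set (X × D)}
    {f : X → D → F} {g : X → E → D}
    (hf : FamilyCk T k f) (hg : FamilyCk S k g) (hST : ∀ p ∈ S, (p.1, g p.1 p.2) ∈ T) :
    FamilyCk S k (fun x u => f x (g x u)) := by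
  have hc : ∀ {F : Type} [NormedAddCommGroup F] [NormedSpace ℝ F] {k : ℕ} {f : X → D → F},
      FamilyCk T k f → ContinuousOn (fun p : X × E => f p.1 (g p.1 p.2)) S :=
    fun h => h.continuousOn.comp (continuousOn_fst.prodMk hg.continuousOn) hST
  induction k generalizing F with
  | zero => exact hc hf
  | succ k ih =>
    have hg0 := hg.of_succ
    obtain ⟨h0, f', h1, h2⟩ := hf
    obtain ⟨i0, g', i1, i2⟩ := hg
    refine ⟨hc (k := 0) h0, fun x u => (f' x (g x u)).comp (g' x u), fun p hp =>
      (h1 _ (hST p hp)).comp p.2 (i1 p hp), ?_⟩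
    exact bilinear (ContinuousLinearMap.compL ℝ E D F) (ih h2 hg0) i2

end FamilyCk

/-- A family which is locally `C^k` is `C^k`. -/
theorem familyCk_univ_of_local {f : X → E → F}
    (h : ∀ p : X × E, ∃ S : Set (X × E), IsOpen S ∧ p ∈ S ∧ FamilyCk S k f) :
    FamilyCk Set.univ k f := by
  choose S hS hp hf using h
  induction k generalizing F with
  | zero =>
    exact continuousOn_univ.2 <| continuous_iff_continuousAt.2 fun p =>
      (hf p).continuousOn.continuousAt ((hS p).mem_nhds (hp p))
  | succ k ih =>
    have hc : ContinuousOn (fun p : X × E => f p.1 p.2) Set.univ :=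
      continuousOn_univ.2 <| continuous_iff_continuousAt.2 fun p =>
        (hf p).continuousOn.continuousAt ((hS p).mem_nhds (hp p))
    -- The local derivatives are glued by taking `fderiv`, with which each of them agrees on its
    -- open set.
    refine ⟨hc, fun x => fderiv ℝ (f x), fun p _ => ?_, ih (fun p => ?_)⟩
    · obtain ⟨h0, f', h1, h2⟩ := hf p
      exact (h1 p (hp p)).differentiableAt.hasFDerivAt
    · obtain ⟨h0, f', h1, h2⟩ := hf p
      exact h2.congr (hS p) fun q hq => (h1 q hq).fderiv.symm

/-- The difference quotient at `0` of a family of functions depending on a real parameter, extended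
by the derivative. -/
def diffQuot (f : ℝ × E → F) (s : ℝ) (u : E) : F :=
  if s = 0 then fderiv ℝ f (0, u) (1, 0) else s⁻¹ • (f (s, u) - f (0, u))

/-- Away from s = 0 this is clear. At s = 0 strict differentiability is needed, since the quotient
compares (s, u') with (0, u') while both approach (0, u). -/
theorem continuous_diffQuot {f : ℝ × E → F} (hf : ContDiff ℝ ∞ f) :
    Continuous fun p : ℝ × E => diffQuot f p.1 p.2 := by
  rw [continuous_iff_continuousAt]
  rintro ⟨s, u⟩
  by_cases hs : s = 0
  · subst hs
    have h1 : HasStrictFDerivAt f (fderiv ℝ f (0, u)) (0, u) :=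
      hf.contDiffAt.hasStrictFDerivAt (by simp)
    have h2 := h1.isLittleO
    have hφ : Filter.Tendsto (fun p : ℝ × E => (p, ((0 : ℝ), p.2))) (𝓝 (0, u))
        (𝓝 (((0 : ℝ), u), ((0 : ℝ), u))) :=
      Continuous.tendsto' (by fun_prop) _ _ rfl
    have h3 := h2.comp_tendsto hφ
    have hd : Continuous fun p : ℝ × E => fderiv ℝ f (0, p.2) (1, 0) := by
      have := (hf.continuous_fderiv (by simp))
      fun_prop
    rw [Metric.continuousAt_iff]
    intro ε hε
    have h4 := h3.def (half_pos hε)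
    have h5 := (Metric.continuous_iff.1 hd) (0, u) ε hε
    obtain ⟨δ, hδ, h5⟩ := h5
    obtain ⟨δ', hδ', h4⟩ := Metric.eventually_nhds_iff.1 h4
    refine ⟨min δ δ', lt_min hδ hδ', ?_⟩
    rintro ⟨s', u'⟩ hp
    have e0 : diffQuot f 0 u = fderiv ℝ f (0, u) (1, 0) := if_pos rfl
    simp only [e0]
    by_cases hs' : s' = 0
    · subst hs'
      rw [diffQuot, if_pos rfl]
      exact h5 _ (hp.trans_le (min_le_left _ _))
    · have := h4 (hp.trans_le (min_le_right _ _))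
      simp only [Function.comp_apply, Prod.mk_sub_mk, sub_zero, sub_self] at this
      rw [diffQuot, if_neg hs', dist_eq_norm]
      have e1 : s'⁻¹ • (f (s', u') - f (0, u')) - fderiv ℝ f (0, u) (1, 0) =
          s'⁻¹ • (f (s', u') - f (0, u') - fderiv ℝ f (0, u) (s', 0)) := by
        have : ((s', 0) : ℝ × E) = s' • ((1, 0) : ℝ × E) := by simp
        rw [this, map_smul, smul_sub _ (_ - _), smul_smul, inv_mul_cancel₀ hs', one_smul]
      have e2 : ‖((s', 0) : ℝ × E)‖ = ‖s'‖ := by simp [Prod.norm_def]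
      rw [e2] at this
      rw [e1, norm_smul, norm_inv]
      have hpos : 0 < ‖s'‖ := norm_pos_iff.2 hs'
      calc ‖s'‖⁻¹ * _ ≤ ‖s'‖⁻¹ * (ε / 2 * ‖s'‖) := by gcongr
        _ = ε / 2 := by field_simp
        _ < ε := half_lt_self hε
  · have h1 : ContinuousAt (fun p : ℝ × E => p.1⁻¹ • (f p - f (0, p.2))) (s, u) := by
      have := hf.continuous
      refine ContinuousAt.smul (continuousAt_fst.inv₀ hs) ?_
      exact Continuous.continuousAt (by fun_prop)
    refine h1.congr ?_
    have : ∀ᶠ p : ℝ × E in 𝓝 (s, u), p.1 ≠ 0 :=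
      continuousAt_fst.eventually_ne hs
    filter_upwards [this] with p hp
    rw [diffQuot, if_neg hp]

/-- The u-derivative of the difference quotient is the difference quotient of the u-derivative, so
the induction closes on itself. At s = 0 this is the symmetry of the second derivative. -/
theorem familyCk_diffQuot {f : ℝ × E → F} (hf : ContDiff ℝ ∞ f) (k : ℕ) :
    FamilyCk Set.univ k (diffQuot f) := by
  induction k generalizing F with
  | zero => exact (continuous_diffQuot hf).continuousOn
  | succ k ih =>
    let f' : ℝ × E → E →L[ℝ] F := fun q => (fderiv ℝ f q).comp (ContinuousLinearMap.inr ℝ ℝ E)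
    have hdf : ContDiff ℝ ∞ (fderiv ℝ f) := hf.fderiv_right (by simp)
    have hf' : ContDiff ℝ ∞ f' := hdf.clm_comp contDiff_const
    have hd : ∀ s u, HasFDerivAt (fun u => f (s, u)) (f' (s, u)) u := fun s u =>
      HasFDerivAt.comp u ((hf.differentiable (by simp)) (s, u)).hasFDerivAt
        (hasFDerivAt_prodMk_right s u)
    refine ⟨(continuous_diffQuot hf).continuousOn, diffQuot f', fun p _ => ?_, ih hf'⟩
    by_cases hs : p.1 = 0
    · have e1 : diffQuot f p.1 = fun u => fderiv ℝ f (0, u) (1, 0) := by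
        funext u; simp [diffQuot, hs]
      rw [e1]
      have h2 := ((hdf.differentiable (by simp)) (0, p.2)).hasFDerivAt
      have h3 : HasFDerivAt (fun u => fderiv ℝ f (0, u))
          ((fderiv ℝ (fderiv ℝ f) (0, p.2)).comp (ContinuousLinearMap.inr ℝ ℝ E)) p.2 :=
        HasFDerivAt.comp p.2 h2 (hasFDerivAt_prodMk_right 0 p.2)
      have h4 := h3.clm_apply (hasFDerivAt_const ((1, 0) : ℝ × E) p.2)
      refine h4.congr_fderiv ?_
      have hsym : IsSymmSndFDerivAt ℝ f (0, p.2) :=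
        hf.contDiffAt.isSymmSndFDerivAt (by
          rw [minSmoothness_of_isRCLikeNormedField]; exact WithTop.coe_le_coe.2 le_top)
      ext v
      have h5 : HasFDerivAt f' (((ContinuousLinearMap.compL ℝ E (ℝ × E) F).flip
          (ContinuousLinearMap.inr ℝ ℝ E)).comp (fderiv ℝ (fderiv ℝ f) (0, p.2))) (0, p.2) :=
        (((ContinuousLinearMap.compL ℝ E (ℝ × E) F).flip
          (ContinuousLinearMap.inr ℝ ℝ E)).hasFDerivAt).comp _ h2
      rw [diffQuot, if_pos hs, h5.fderiv]
      simpa using (hsym.eq (0, v) (1, 0))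
    · have e1 : diffQuot f p.1 = fun u => p.1⁻¹ • (f (p.1, u) - f (0, u)) := by
        funext u; simp [diffQuot, hs]
      have e2 : diffQuot f' p.1 p.2 = p.1⁻¹ • (f' (p.1, p.2) - f' (0, p.2)) := by
        simp [diffQuot, hs]
      rw [e1, e2]
      exact ((hd p.1 p.2).sub (hd 0 p.2)).const_smul _

end ParametricSmoothness

/-! ### The C^∞ topology in terms of parametric families -/

section VectTopology

variable {n : ℕ}

/-- The vector field on `ℝⁿ` given by a smooth function. -/
def W.ofContDiff (f : Rn n → Rn n) (hf : ContDiff ℝ ∞ f) : W n where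
  toFun := f
  contMDiff_toFun := contMDiff_vectorSpace_iff_contDiff.2 hf

theorem W.lie_apply (A B : W n) (u : Rn n) :
    (⁅A, B⁆ u : Rn n) = fderiv ℝ (fun u => (B u : Rn n)) u (A u) -
      fderiv ℝ (fun u => (A u : Rn n)) u (B u) := by
  rw [GelfandFuks.lie_apply, ← VectorField.mlieBracketWithin_univ,
    VectorField.mlieBracketWithin_eq_lieBracketWithin]
  exact congrFun (VectorField.lieBracketWithin_univ (𝕜 := ℝ) (V := fun u => (A u : Rn n))
    (W := fun u => (B u : Rn n))) u

theorem chartRep_W (p : Rn n) (A : W n) : chartRep p A = fun u => (A u : Rn n) :=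
  VectorField.mpullback_id

/-- A family of vector fields on `ℝⁿ`, all of whose derivatives depend continuously on the
parameter, is continuous. -/
theorem continuous_of_familyCk {X : Type*} [TopologicalSpace X] {B : X → W n}
    (h : ∀ k, FamilyCk Set.univ k (fun x u => (B x u : Rn n))) : Continuous B := by
  refine continuous_iInf_rng.2 fun p => continuous_iInf_rng.2 fun k => continuous_induced_rng.2 ?_
  have hc := continuousOn_univ.1 ((h k).continuousOn_iteratedFDeriv isOpen_univ)
  rw [continuous_iff_continuousAt]
  intro x₀
  rw [ContinuousAt, UniformOnFun.tendsto_iff_tendstoUniformlyOn]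
  rintro K ⟨hK, -⟩ U hU
  -- Joint continuity becomes uniform closeness on the compact set `K` for all parameters near `x₀`.
  obtain ⟨v, hv, hvK⟩ := hK.mem_uniformity_of_prod
    (f := fun x u => iteratedFDeriv ℝ k (fun u => (B x u : Rn n)) u)
    (s := Set.univ) (q := x₀) hc.continuousOn (Set.mem_univ _) (symm_le_uniformity hU)
  rw [nhdsWithin_univ] at hv
  filter_upwards [hv] with x hx u hu
  have := hvK x hx u hu
  simp only [Function.comp_apply, chartRep_W]
  exact this

variable {M : Type*} [TopologicalSpace M] [ChartedSpace (Rn n) M] [IsManifold (𝓡 n) ∞ M]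

theorem contMDiffAt_chartAt_symm (p : M) {y : Rn n} (hy : y ∈ (chartAt (Rn n) p).target) :
    ContMDiffAt (𝓡 n) (𝓡 n) ∞ (chartAt (Rn n) p).symm y :=
  contMDiffOn_chart_symm.contMDiffAt ((chartAt (Rn n) p).open_target.mem_nhds hy)

theorem contMDiffAt_chartAt (p : M) {x : M} (hx : x ∈ (chartAt (Rn n) p).source) :
    ContMDiffAt (𝓡 n) (𝓡 n) ∞ (chartAt (Rn n) p) x :=
  contMDiffOn_chart.contMDiffAt ((chartAt (Rn n) p).open_source.mem_nhds hx)

/-- The differential of the chart at `p`, as a function with values in a fixed space. -/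
def chartDeriv (p x : M) : Rn n →L[ℝ] Rn n :=
  mfderiv (𝓡 n) (𝓡 n) (chartAt (Rn n) p) x

/-- The differential of the inverse of the chart at `p`, as a function with values in a fixed
space. -/
def chartSymmDeriv (p : M) (y : Rn n) : Rn n →L[ℝ] Rn n :=
  mfderiv (𝓡 n) (𝓡 n) (chartAt (Rn n) p).symm y

theorem chartDeriv_comp_chartSymmDeriv (p : M) {y : Rn n} (hy : y ∈ (chartAt (Rn n) p).target) :
    (chartDeriv p ((chartAt (Rn n) p).symm y)).comp (chartSymmDeriv p y) =
      ContinuousLinearMap.id ℝ (Rn n) := by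
  set e := chartAt (Rn n) p
  have hx := e.map_target hy
  have h1 := mfderiv_comp y ((contMDiffAt_chartAt p hx).mdifferentiableAt (by simp))
    ((contMDiffAt_chartAt_symm p hy).mdifferentiableAt (by simp))
  have : (e ∘ e.symm) =ᶠ[𝓝 y] id := by
    filter_upwards [e.open_target.mem_nhds hy] with z hz
    exact e.right_inv hz
  rw [this.mfderiv_eq] at h1
  exact h1.symm.trans mfderiv_id

theorem chartSymmDeriv_comp_chartDeriv (p : M) {x : M} (hx : x ∈ (chartAt (Rn n) p).source) :
    (chartSymmDeriv p (chartAt (Rn n) p x)).comp (chartDeriv p x) =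
      ContinuousLinearMap.id ℝ (Rn n) := by
  set e := chartAt (Rn n) p
  have hy := e.map_source hx
  have h1 := mfderiv_comp x ((contMDiffAt_chartAt_symm p hy).mdifferentiableAt (by simp))
    ((contMDiffAt_chartAt p hx).mdifferentiableAt (by simp))
  have : (e.symm ∘ e) =ᶠ[𝓝 x] id := by
    filter_upwards [e.open_source.mem_nhds hx] with z hz
    exact e.left_inv hz
  rw [this.mfderiv_eq] at h1
  exact h1.symm.trans mfderiv_id

theorem chartSymmDeriv_comp_chartDeriv' (p : M) {y : Rn n}
    (hy : y ∈ (chartAt (Rn n) p).target) :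
    (chartSymmDeriv p y).comp (chartDeriv p ((chartAt (Rn n) p).symm y)) =
      ContinuousLinearMap.id ℝ (Rn n) := by
  have h := chartSymmDeriv_comp_chartDeriv p ((chartAt (Rn n) p).map_target hy)
  rwa [(chartAt (Rn n) p).right_inv hy] at h

theorem chartRep_apply (p : M) (A : Vect n M) {y : Rn n} (hy : y ∈ (chartAt (Rn n) p).target) :
    chartRep p A y = chartDeriv p ((chartAt (Rn n) p).symm y) (A ((chartAt (Rn n) p).symm y)) := by
  have : (chartSymmDeriv p y).inverse = chartDeriv p ((chartAt (Rn n) p).symm y) :=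
    ContinuousLinearMap.inverse_eq (chartSymmDeriv_comp_chartDeriv' p hy)
      (chartDeriv_comp_chartSymmDeriv p hy)
  rw [← this]
  rfl

theorem contDiffAt_chartRep (p : M) (A : Vect n M) {y : Rn n}
    (hy : y ∈ (chartAt (Rn n) p).target) : ContDiffAt ℝ ∞ (chartRep p A) y := by
  refine contMDiffAt_vectorSpace_iff_contDiffAt.1 ?_
  refine ContMDiffAt.mpullback_vectorField_preimage (n := ∞) A.contMDiff.contMDiffAt
    (contMDiffAt_chartAt_symm p hy) ?_ (by simp)
  exact ContinuousLinearMap.IsInvertible.of_inverse (chartSymmDeriv_comp_chartDeriv' p hy)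
    (chartDeriv_comp_chartSymmDeriv p hy)

/-- The expression of a vector field in a chart, as a family of functions which depends on the
vector field. -/
theorem familyCk_chartRep (p : M) (k : ℕ) :
    FamilyCk (Set.univ ×ˢ (chartAt (Rn n) p).target) k (fun A : Vect n M => chartRep p A) := by
  refine FamilyCk.of_iteratedFDeriv (fun q hq => (contDiffAt_chartRep p q.1 hq.2).of_le
    (WithTop.coe_le_coe.2 le_top)) fun j _ q hq => ContinuousAt.continuousWithinAt ?_
  obtain ⟨A, y⟩ := q
  let 𝔖 := {K : Set (Rn n) | IsCompact K ∧ K ⊆ (chartAt (Rn n) p).target}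
  -- Evaluation is jointly continuous for uniform convergence on `𝔖` at points having a
  -- neighbourhood in `𝔖`; local compactness provides one inside the chart target.
  have h1 : ∃ V ∈ 𝔖, V ∈ 𝓝 y := by
    obtain ⟨K, hK, hy, hKt⟩ := exists_compact_subset (chartAt (Rn n) p).open_target hq.2
    exact ⟨K, ⟨hK, hKt⟩, mem_interior_iff_mem_nhds.1 hy⟩
  have h2 : Continuous fun X : Vect n M =>
      UniformOnFun.ofFun 𝔖 (iteratedFDeriv ℝ j (chartRep p X)) := by
    apply continuous_iff_le_induced.2
    exact (iInf_le _ p).trans (iInf_le _ j)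
  have h3 : ContinuousAt (UniformOnFun.toFun 𝔖
      (UniformOnFun.ofFun 𝔖 (iteratedFDeriv ℝ j (chartRep p A)))) y :=
    (contDiffAt_chartRep p A hq.2).continuousAt_iteratedFDeriv (by exact_mod_cast le_top)
  have h4 := UniformOnFun.continuousAt_eval₂ h1 h3
  exact ContinuousAt.comp (x := (A, y)) (f := fun q : Vect n M × Rn n =>
    (UniformOnFun.ofFun 𝔖 (iteratedFDeriv ℝ j (chartRep p q.1)), q.2)) h4
    ((h2.comp continuous_fst).prodMk continuous_snd).continuousAt

end VectTopology

/-! ### Smooth families of vector fields and the product rule for cochains -/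

section SmoothFamilies

variable {n : ℕ} {P : Type} [NormedAddCommGroup P] [NormedSpace ℝ P]

/-- A family of vector fields on `ℝⁿ` which depends smoothly on a parameter. -/
def IsSmoothFamily (B : P → W n) : Prop :=
  ContDiff ℝ ∞ fun z : P × Rn n => (B z.1 z.2 : Rn n)

namespace IsSmoothFamily

theorem continuous {B : P → W n} (hB : IsSmoothFamily B) : Continuous B :=
  continuous_of_familyCk fun k =>
    FamilyCk.of_contDiffOn isOpen_univ (f := fun z : P × Rn n => (B z.1 z.2 : Rn n))
      hB.contDiffOn k

theorem contDiff_fderiv {B : P → W n} (hB : IsSmoothFamily B) (e : P) :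
    ContDiff ℝ ∞ fun z : P × Rn n => fderiv ℝ (fun z : P × Rn n => (B z.1 z.2 : Rn n)) z (e, 0) :=
  (ContDiff.fderiv_right (m := ∞) hB (by simp)).clm_apply contDiff_const

/-- The derivative of a smooth family of vector fields in the direction of the vector `e` of the
space of parameters. -/
def deriv {B : P → W n} (hB : IsSmoothFamily B) (e : P) (t : P) : W n :=
  W.ofContDiff (fun u => fderiv ℝ (fun z : P × Rn n => (B z.1 z.2 : Rn n)) (t, u) (e, 0))
    ((hB.contDiff_fderiv e).comp (contDiff_prodMk_right t))

theorem isSmoothFamily_deriv {B : P → W n} (hB : IsSmoothFamily B) (e : P) :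
    IsSmoothFamily (hB.deriv e) :=
  hB.contDiff_fderiv e

theorem comp_line {B : P → W n} (hB : IsSmoothFamily B) (t e : P) :
    IsSmoothFamily fun s : ℝ => B (t + s • e) :=
  ContDiff.comp (g := fun z : P × Rn n => (B z.1 z.2 : Rn n))
    (f := fun z : ℝ × Rn n => (t + z.1 • e, z.2)) hB (by fun_prop)

/-- Differentiability of `B` along a line in the C^∞ topology, in a form without norms: the
difference quotient, completed by the derivative at s = 0, is a continuous curve of vector fields. A
cochain can then be applied to it using continuity alone. -/
theorem exists_continuous_diffQuot {B : P → W n} (hB : IsSmoothFamily B) (t e : P) :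
    ∃ Q : ℝ → W n, Continuous Q ∧ Q 0 = hB.deriv e t ∧ ∀ s, B (t + s • e) = B t + s • Q s := by
  let f : ℝ × Rn n → Rn n := fun z => B (t + z.1 • e) z.2
  have hf : ContDiff ℝ ∞ f := hB.comp_line t e
  have hq : ∀ s, ContDiff ℝ ∞ (diffQuot f s) := by
    intro s
    by_cases hs : s = 0
    · subst hs
      have : diffQuot f 0 = fun u => fderiv ℝ f (0, u) (1, 0) := by
        funext u; simp [diffQuot]
      rw [this]
      exact ((hf.fderiv_right (by simp)).clm_apply contDiff_const).comp (contDiff_prodMk_right 0)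
    · have : diffQuot f s = fun u => s⁻¹ • (f (s, u) - f (0, u)) := by
        funext u; simp [diffQuot, hs]
      rw [this]
      exact ((hf.comp (contDiff_prodMk_right s)).sub (hf.comp (contDiff_prodMk_right 0))).const_smul _
  refine ⟨fun s => W.ofContDiff (diffQuot f s) (hq s),
    continuous_of_familyCk fun k => familyCk_diffQuot hf k, ?_, fun s => ?_⟩
  · ext u : 1
    change diffQuot f 0 u = fderiv ℝ (fun z : P × Rn n => (B z.1 z.2 : Rn n)) (t, u) (e, 0)
    rw [diffQuot, if_pos rfl]
    have h1 : HasFDerivAt (fun z : P × Rn n => (B z.1 z.2 : Rn n))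
        (fderiv ℝ (fun z : P × Rn n => (B z.1 z.2 : Rn n)) (t + (0 : ℝ) • e, u))
        (t + (0 : ℝ) • e, u) :=
      ((ContDiff.differentiable hB (by simp)) _).hasFDerivAt
    have h2 : HasFDerivAt (fun z : ℝ × Rn n => (t + z.1 • e, z.2))
        (((ContinuousLinearMap.fst ℝ ℝ (Rn n)).smulRight e).prod
          (ContinuousLinearMap.snd ℝ ℝ (Rn n))) (0, u) :=
      HasFDerivAt.prodMk
        (((ContinuousLinearMap.fst ℝ ℝ (Rn n)).smulRight e).hasFDerivAt.const_add t)
        (ContinuousLinearMap.snd ℝ ℝ (Rn n)).hasFDerivAt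
    have h3 := h1.comp ((0 : ℝ), u) h2
    have h4 : fderiv ℝ f (0, u) = _ := h3.fderiv
    rw [h4]
    simp
  · ext u : 1
    have h0 : f (0, u) = B t u := by
      change (B (t + (0 : ℝ) • e) u : Rn n) = _
      rw [zero_smul, add_zero]
    have h1 : f (s, u) = f (0, u) + s • diffQuot f s u := by
      by_cases hs : s = 0
      · simp [hs]
      · rw [diffQuot, if_neg hs, smul_smul, mul_inv_cancel₀ hs, one_smul, add_sub_cancel]
    rw [h0] at h1
    exact h1

end IsSmoothFamily

/-- The product rule for a continuous multilinear form evaluated on smooth families of vector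
fields. -/
theorem hasDerivAt_cochain {k : ℕ} (c : W n [⋀^Fin k]→L[ℝ] ℂ) {B : Fin k → P → W n}
    (hB : ∀ i, IsSmoothFamily (B i)) (t e : P) :
    HasDerivAt (fun s : ℝ => c (fun i => B i (t + s • e)))
      (∑ i, c (Function.update (fun i => B i t) i ((hB i).deriv e t))) 0 := by
  choose Q hQ hQ0 hQs using fun i => (hB i).exists_continuous_diffQuot t e
  let x : Fin k → W n := fun i => B i t
  let f := c.toMultilinearMap
  have hS : ∀ s : Finset (Fin k), Continuous fun r : ℝ =>
      c (s.piecewise (fun i => Q i r) x) := by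
    intro s
    refine c.cont.comp (continuous_pi fun i => ?_)
    by_cases h : i ∈ s
    · simpa [h] using hQ i
    · simpa [h] using continuous_const
  -- Multilinear expansion of c(x + rQ) over the set `s` of slots receiving rQ. A set of size at
  -- least 2 carries `r ^ s.card`; after one factor r is taken out, a positive power is left, which
  -- kills the term at r = 0.
  have key : ∀ r : ℝ, c (fun i => B i (t + r • e)) = c x + r • (f.linearDeriv x (fun i => Q i r)) +
      r • ∑ s : Finset (Fin k) with 2 ≤ s.card,
        r ^ (s.card - 1) • c (s.piecewise (fun i => Q i r) x) := by
    intro r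
    have h1 : (fun i => B i (t + r • e)) = x + r • fun i => Q i r := by
      funext i; exact hQs i r
    have h2 := f.map_add_eq_map_add_linearDeriv_add x (r • fun i => Q i r)
    rw [h1]
    refine h2.trans ?_
    rw [map_smul]
    congr 1
    rw [Finset.smul_sum]
    refine Finset.sum_congr rfl fun s hs => ?_
    have h3 := f.map_piecewise_smul (fun _ => r) (s.piecewise (fun i => Q i r) x) s
    have h4 : s.piecewise (fun i => r • s.piecewise (fun i => Q i r) x i)
        (s.piecewise (fun i => Q i r) x) = s.piecewise (r • fun i => Q i r) x := by
      funext i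
      by_cases h : i ∈ s <;> simp [h]
    rw [h4] at h3
    rw [h3, Finset.prod_const, smul_smul, ← pow_succ', Nat.sub_add_cancel]
    · rfl
    · have := (Finset.mem_filter.1 hs).2
      omega
  let R : ℝ → ℂ := fun r => f.linearDeriv x (fun i => Q i r) +
    ∑ s : Finset (Fin k) with 2 ≤ s.card, r ^ (s.card - 1) • c (s.piecewise (fun i => Q i r) x)
  have hR : Continuous R := by
    refine Continuous.add ?_ (continuous_finsetSum _ fun s _ => (continuous_id.pow _).smul (hS s))
    simp only [MultilinearMap.linearDeriv_apply]
    refine continuous_finsetSum _ fun i _ => c.cont.comp ?_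
    exact continuous_const.update i (hQ i)
  have hR0 : R 0 = ∑ i, c (Function.update (fun i => B i t) i ((hB i).deriv e t)) := by
    have : ∑ s : Finset (Fin k) with 2 ≤ s.card,
        (0 : ℝ) ^ (s.card - 1) • c (s.piecewise (fun i => Q i 0) x) = 0 := by
      refine Finset.sum_eq_zero fun s hs => ?_
      have := (Finset.mem_filter.1 hs).2
      rw [zero_pow (by omega), zero_smul]
    simp only [R]
    rw [this, add_zero, MultilinearMap.linearDeriv_apply]
    simp only [hQ0]
    rfl
  have key' : ∀ r : ℝ, c (fun i => B i (t + r • e)) = c x + r • R r := by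
    intro r
    rw [key, smul_add, add_assoc]
  rw [hasDerivAt_iff_tendsto_slope_zero, ← hR0]
  refine (hR.continuousAt.tendsto.mono_left nhdsWithin_le_nhds).congr' ?_
  filter_upwards [self_mem_nhdsWithin] with r hr
  have hr : r ≠ 0 := hr
  rw [zero_add, key', key', zero_smul, add_zero, add_sub_cancel_left, smul_smul,
    inv_mul_cancel₀ hr, one_smul]

end SmoothFamilies

/-! ### Related vector fields on a product -/

section RelatedFields

variable {E F : Type*} [NormedAddCommGroup E] [NormedSpace ℝ E]
  [NormedAddCommGroup F] [NormedSpace ℝ F]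

/-- Brackets of related vector fields are related. -/
theorem fderiv_lieBracket_of_related {f : E → F} {z : E} (hf : ContDiffAt ℝ ∞ f z)
    {X₁ X₂ : E → E} {Y₁ Y₂ : F → F} (hX₁ : DifferentiableAt ℝ X₁ z) (hX₂ : DifferentiableAt ℝ X₂ z)
    (hY₁ : DifferentiableAt ℝ Y₁ (f z)) (hY₂ : DifferentiableAt ℝ Y₂ (f z))
    (h₁ : ∀ᶠ z' in 𝓝 z, fderiv ℝ f z' (X₁ z') = Y₁ (f z'))
    (h₂ : ∀ᶠ z' in 𝓝 z, fderiv ℝ f z' (X₂ z') = Y₂ (f z')) :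
    fderiv ℝ f z (fderiv ℝ X₂ z (X₁ z) - fderiv ℝ X₁ z (X₂ z)) =
      fderiv ℝ Y₂ (f z) (Y₁ (f z)) - fderiv ℝ Y₁ (f z) (Y₂ (f z)) := by
  have hd : HasFDerivAt f (fderiv ℝ f z) z := (hf.differentiableAt (by simp)).hasFDerivAt
  have hdd : HasFDerivAt (fderiv ℝ f) (fderiv ℝ (fderiv ℝ f) z) z :=
    ((hf.fderiv_right (m := ∞) (by simp)).differentiableAt (by simp)).hasFDerivAt
  have hsym : IsSymmSndFDerivAt ℝ f z := hf.isSymmSndFDerivAt (by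
    rw [minSmoothness_of_isRCLikeNormedField]; exact WithTop.coe_le_coe.2 le_top)
  -- The relation f'(X) = Y ∘ f is differentiated in the direction v. When the two instances are
  -- subtracted, the second derivatives of f cancel by symmetry.
  have key : ∀ {X : E → E} {Y : F → F}, DifferentiableAt ℝ X z → DifferentiableAt ℝ Y (f z) →
      (∀ᶠ z' in 𝓝 z, fderiv ℝ f z' (X z') = Y (f z')) → ∀ v,
      fderiv ℝ f z (fderiv ℝ X z v) + fderiv ℝ (fderiv ℝ f) z v (X z) =
        fderiv ℝ Y (f z) (fderiv ℝ f z v) := by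
    intro X Y hX hY h v
    have e1 := hdd.clm_apply hX.hasFDerivAt
    have e2 := hY.hasFDerivAt.comp z hd
    have e3 := e1.unique (e2.congr_of_eventuallyEq h)
    have := DFunLike.congr_fun e3 v
    simpa using this
  have k₁ := key hX₁ hY₁ h₁ (X₂ z)
  have k₂ := key hX₂ hY₂ h₂ (X₁ z)
  rw [h₂.self_of_nhds] at k₁
  rw [h₁.self_of_nhds] at k₂
  rw [← k₁, ← k₂, map_sub, hsym.eq (X₂ z) (X₁ z)]
  abel

variable {P G : Type*} [NormedAddCommGroup P] [NormedSpace ℝ P]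
  [NormedAddCommGroup G] [NormedSpace ℝ G]

theorem fderiv_prodMk_const_neg {T : P × E → E} {z : P × E} (hT : DifferentiableAt ℝ T z) (w : P)
    (v : P × E) : fderiv ℝ (fun z => (w, -T z)) z v = (0, -fderiv ℝ T z v) := by
  rw [((hasFDerivAt_const w z).prodMk hT.hasFDerivAt.fun_neg).fderiv]
  simp

theorem eventually_fderiv_eq_zero {f : P × E → G} {z : P × E} {T : P × E → E} {w : P}
    (h : ∀ᶠ z in 𝓝 z, fderiv ℝ f z (0, T z) = fderiv ℝ f z (w, 0)) :
    ∀ᶠ z in 𝓝 z, fderiv ℝ f z (w, -T z) = (fun _ => 0 : G → G) (f z) := by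
  filter_upwards [h] with z hz
  have e : (w, -T z) = (w, 0) - (0, T z) := by simp
  rw [e, map_sub, hz, sub_self]

theorem eq_zero_of_fderiv_eq_zero {f : P × E → G} {z : P × E}
    (hinv : ((fderiv ℝ f z).comp (ContinuousLinearMap.inr ℝ P E)).IsInvertible) {x : E}
    (h : fderiv ℝ f z (0, x) = 0) : x = 0 := by
  have := hinv.inverse_apply_self x
  rw [← this]
  simp [h]

/-- The field (w, −T) is f-related to 0 and (0, B) to Y, so f' kills their bracket. That bracket is
vertical because w is constant, and f' is injective on vertical vectors; hence its vertical
component, ∂_w B minus the fibrewise bracket of T and B, is zero. -/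
theorem fderiv_inl_of_related {f : P × E → G} {z : P × E} (hf : ContDiffAt ℝ ∞ f z)
    (hinv : ((fderiv ℝ f z).comp (ContinuousLinearMap.inr ℝ P E)).IsInvertible)
    {T B : P × E → E} {Y : G → G} {w : P} (hT : DifferentiableAt ℝ T z)
    (hB : DifferentiableAt ℝ B z) (hY : DifferentiableAt ℝ Y (f z))
    (h₁ : ∀ᶠ z in 𝓝 z, fderiv ℝ f z (0, T z) = fderiv ℝ f z (w, 0))
    (h₂ : ∀ᶠ z in 𝓝 z, fderiv ℝ f z (0, B z) = Y (f z)) :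
    fderiv ℝ B z (w, 0) = fderiv ℝ B z (0, T z) - fderiv ℝ T z (0, B z) := by
  have key := fderiv_lieBracket_of_related (X₁ := fun z => (w, -T z)) (X₂ := fun z => (0, B z))
    (Y₁ := fun _ => 0) (Y₂ := Y) hf ((differentiableAt_const _).prodMk hT.fun_neg)
    ((differentiableAt_const _).prodMk hB) (differentiableAt_const _) hY
    (eventually_fderiv_eq_zero h₁) h₂
  rw [((hasFDerivAt_const (0 : P) z).prodMk hB.hasFDerivAt).fderiv,
    fderiv_prodMk_const_neg hT] at key
  simp only [ContinuousLinearMap.prod_apply, zero_apply, map_zero,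
    fderiv_fun_const, Pi.zero_apply, Prod.mk_sub_mk, sub_self, sub_neg_eq_add] at key
  have k := eq_zero_of_fderiv_eq_zero hinv key
  have e : (w, -T z) = (w, 0) - (0, T z) := by simp
  rw [e, map_sub] at k
  rw [← sub_eq_zero]
  refine Eq.trans ?_ k
  abel

/-- The same argument for (w, −T) and (w', −T'), both f-related to 0. This expresses the flatness of
the connection whose horizontal vectors are the kernel of f'. -/
theorem fderiv_inl_sub_fderiv_inl {f : P × E → G} {z : P × E} (hf : ContDiffAt ℝ ∞ f z)
    (hinv : ((fderiv ℝ f z).comp (ContinuousLinearMap.inr ℝ P E)).IsInvertible)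
    {T T' : P × E → E} {w w' : P} (hT : DifferentiableAt ℝ T z) (hT' : DifferentiableAt ℝ T' z)
    (h₁ : ∀ᶠ z in 𝓝 z, fderiv ℝ f z (0, T z) = fderiv ℝ f z (w, 0))
    (h₂ : ∀ᶠ z in 𝓝 z, fderiv ℝ f z (0, T' z) = fderiv ℝ f z (w', 0)) :
    fderiv ℝ T' z (w, 0) - fderiv ℝ T z (w', 0) =
      fderiv ℝ T' z (0, T z) - fderiv ℝ T z (0, T' z) := by
  have key := fderiv_lieBracket_of_related (X₁ := fun z => (w, -T z))
    (X₂ := fun z => (w', -T' z)) (Y₁ := fun _ => 0) (Y₂ := fun _ => 0) hf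
    ((differentiableAt_const _).prodMk hT.fun_neg) ((differentiableAt_const _).prodMk hT'.fun_neg)
    (differentiableAt_const _) (differentiableAt_const _)
    (eventually_fderiv_eq_zero h₁) (eventually_fderiv_eq_zero h₂)
  rw [fderiv_prodMk_const_neg hT, fderiv_prodMk_const_neg hT'] at key
  simp only [zero_apply, fderiv_fun_const, Pi.zero_apply, sub_zero,
    Prod.mk_sub_mk] at key
  have k := eq_zero_of_fderiv_eq_zero hinv key
  have e : (w, -T z) = (w, 0) - (0, T z) := by simp
  have e' : (w', -T' z) = (w', 0) - (0, T' z) := by simp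
  rw [e, e', map_sub, map_sub] at k
  rw [← sub_eq_zero, ← neg_eq_zero]
  refine Eq.trans ?_ k
  abel

end RelatedFields

/-! ### Derivatives of the fields t_v and of pulled-back fields -/

section Coordinates

variable {n : ℕ} {M : Type*} [TopologicalSpace M] [ChartedSpace (Rn n) M]
  [IsManifold (𝓡 n) ∞ M] {P : Type} [NormedAddCommGroup P] [NormedSpace ℝ P]

namespace CoordFamily

variable (φ : CoordFamily n M)

/-- The vector field on `ℝⁿ` determined by the image under a map `F : P → M` of a vector `w`
tangent to `P`. -/
def along (F : P → M) (w : P) (t : P) : W n :=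
  φ.t (F t) (mfderiv 𝓘(ℝ, P) (𝓡 n) F t w)

theorem t_apply (x : M) (v : TangentSpace (𝓡 n) x) (u : Rn n) :
    (φ.t x v u : Rn n) = (mfderiv (𝓡 n) (𝓡 n) (φ.toFun x) u).inverse
      ((mfderiv (𝓡 n) (𝓡 n) (fun y => φ.toFun y u) x :
        TangentSpace (𝓡 n) x →L[ℝ] TangentSpace (𝓡 n) (φ.toFun x u)) v) := rfl

theorem pull_apply (x : M) (A : Vect n M) (u : Rn n) :
    (φ.pull x A u : Rn n) =
      (mfderiv (𝓡 n) (𝓡 n) (φ.toFun x) u).inverse (A (φ.toFun x u)) := rfl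

/-- The vector field `t_v` depends linearly on the vector `v`. -/
def tLM (x : M) : TangentSpace (𝓡 n) x →ₗ[ℝ] W n where
  toFun := φ.t x
  map_add' v w := by
    ext u : 1
    refine Eq.trans (φ.t_apply x (v + w) u) ?_
    rw [map_add, map_add]
    rfl
  map_smul' c v := by
    ext u : 1
    refine Eq.trans (φ.t_apply x (c • v) u) ?_
    rw [map_smul, map_smul]
    rfl

/-- The pull-back of vector fields is linear. -/
def pullLM (x : M) : Vect n M →ₗ[ℝ] W n where
  toFun := φ.pull x
  map_add' v w := by
    ext u : 1
    refine Eq.trans (φ.pull_apply x (v + w) u) ?_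
    rw [ContMDiffSection.coe_add, Pi.add_apply, map_add]
    rfl
  map_smul' c v := by
    ext u : 1
    refine Eq.trans (φ.pull_apply x (c • v) u) ?_
    rw [ContMDiffSection.coe_smul, Pi.smul_apply, map_smul]
    rfl

theorem pull_lie (x : M) (A B : Vect n M) : φ.pull x ⁅A, B⁆ = ⁅φ.pull x A, φ.pull x B⁆ := by
  ext u : 1
  have : IsManifold (𝓡 n) (minSmoothness ℝ 3) M := by
    rw [minSmoothness_of_isRCLikeNormedField]
    exact IsManifold.of_le (n := ∞) (WithTop.coe_le_coe.2 le_top)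
  exact VectorField.mpullback_mlieBracket (A.mdiffAt _) (B.mdiffAt _)
    (φ.contMDiff_toFun x u) (by
      rw [minSmoothness_of_isRCLikeNormedField]; exact WithTop.coe_le_coe.2 le_top)

variable {F : P → M}

theorem contMDiff_comp (hF : ContMDiff 𝓘(ℝ, P) (𝓡 n) ∞ F) :
    ContMDiff 𝓘(ℝ, P × Rn n) (𝓡 n) ∞ fun z : P × Rn n => φ.toFun (F z.1) z.2 :=
  φ.smooth.comp ((hF.comp contDiff_fst.contMDiff).prodMk contDiff_snd.contMDiff)

theorem mfderiv_comp_inr (hF : ContMDiff 𝓘(ℝ, P) (𝓡 n) ∞ F) (t : P) (u v : Rn n) :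
    (mfderiv 𝓘(ℝ, P × Rn n) (𝓡 n) (fun z : P × Rn n => φ.toFun (F z.1) z.2) (t, u)
      ((0, v) : P × Rn n) : Rn n) = mfderiv (𝓡 n) (𝓡 n) (φ.toFun (F t)) u v := by
  have h := ((φ.contMDiff_comp hF).mdifferentiableAt (x := (t, u)) (by simp)).hasMFDerivAt
  have h1 : HasMFDerivAt (𝓡 n) 𝓘(ℝ, P × Rn n) (fun u : Rn n => (t, u)) u
      (ContinuousLinearMap.inr ℝ P (Rn n)) := (hasFDerivAt_prodMk_right t u).hasMFDerivAt
  have h2 := (HasMFDerivAt.comp u h h1).mfderiv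
  exact (DFunLike.congr_fun h2 v).symm

theorem mfderiv_comp_inl (hF : ContMDiff 𝓘(ℝ, P) (𝓡 n) ∞ F) (t w : P) (u : Rn n) :
    (mfderiv 𝓘(ℝ, P × Rn n) (𝓡 n) (fun z : P × Rn n => φ.toFun (F z.1) z.2) (t, u)
      ((w, 0) : P × Rn n) : Rn n) = (mfderiv (𝓡 n) (𝓡 n) (fun y => φ.toFun y u) (F t) :
        TangentSpace (𝓡 n) (F t) →L[ℝ] TangentSpace (𝓡 n) (φ.toFun (F t) u))
          (mfderiv 𝓘(ℝ, P) (𝓡 n) F t w) := by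
  have h := ((φ.contMDiff_comp hF).mdifferentiableAt (x := (t, u)) (by simp)).hasMFDerivAt
  have h1 : HasMFDerivAt 𝓘(ℝ, P) 𝓘(ℝ, P × Rn n) (fun t : P => (t, u)) t
      (ContinuousLinearMap.inl ℝ P (Rn n)) := (hasFDerivAt_prodMk_left t u).hasMFDerivAt
  have h2 := (HasMFDerivAt.comp t h h1).mfderiv
  have h3 : ContMDiff (𝓡 n) (𝓡 n) ∞ fun y => φ.toFun y u :=
    φ.smooth.comp (contMDiff_id.prodMk contMDiff_const)
  have h4 := (HasMFDerivAt.comp t ((h3.mdifferentiableAt (x := F t) (by simp)).hasMFDerivAt)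
    ((hF.mdifferentiableAt (x := t) (by simp)).hasMFDerivAt)).mfderiv
  exact (DFunLike.congr_fun (h2.symm.trans h4) w)

/-- The local expression in a chart of `M` of the map `(t, u) ↦ φ (F t) u`, and of the vector
fields on `ℝⁿ` which are derived from it. -/
theorem exists_local_form (hF : ContMDiff 𝓘(ℝ, P) (𝓡 n) ∞ F) (z₀ : P × Rn n) :
    ∃ (p : M) (N : Set (P × Rn n)) (Ψ : P × Rn n → Rn n), IsOpen N ∧ z₀ ∈ N ∧
      ContDiffOn ℝ ∞ Ψ N ∧ ∀ z ∈ N, Ψ z ∈ (chartAt (Rn n) p).target ∧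
        ((fderiv ℝ Ψ z).comp (ContinuousLinearMap.inr ℝ P (Rn n))).IsInvertible ∧
        (∀ w, fderiv ℝ Ψ z (0, (φ.along F w z.1 z.2 : Rn n)) = fderiv ℝ Ψ z (w, 0)) ∧
        ∀ A, fderiv ℝ Ψ z (0, (φ.pull (F z.1) A z.2 : Rn n)) = chartRep p A (Ψ z) := by
  let Φ : P × Rn n → M := fun z => φ.toFun (F z.1) z.2
  have hΦ : ContMDiff 𝓘(ℝ, P × Rn n) (𝓡 n) ∞ Φ := φ.contMDiff_comp hF
  let p := Φ z₀
  let e := chartAt (Rn n) p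
  have hN : IsOpen (Φ ⁻¹' e.source) := e.open_source.preimage hΦ.continuous
  have hd : ∀ z ∈ Φ ⁻¹' e.source, ∀ v, fderiv ℝ (e ∘ Φ) z v =
      chartDeriv p (Φ z) (mfderiv 𝓘(ℝ, P × Rn n) (𝓡 n) Φ z v) := by
    intro z hz v
    have h := mfderiv_comp z ((contMDiffAt_chartAt p hz).mdifferentiableAt (by simp))
      (hΦ.mdifferentiableAt (x := z) (by simp))
    rw [mfderiv_eq_fderiv] at h
    exact DFunLike.congr_fun h v
  refine ⟨p, Φ ⁻¹' e.source, e ∘ Φ, hN, mem_chart_source (Rn n) p, ?_, fun z hz => ?_⟩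
  · intro z hz
    exact (contMDiffAt_iff_contDiffAt.1 (ContMDiffAt.comp z (contMDiffAt_chartAt p hz)
      (hΦ z))).contDiffWithinAt
  have hinv : (mfderiv (𝓡 n) (𝓡 n) (φ.toFun (F z.1)) z.2).IsInvertible :=
    φ.isInvertible_mfderiv _ _
  refine ⟨e.map_source hz, ?_, fun w => ?_, fun A => ?_⟩
  · have h1 : (fderiv ℝ (e ∘ Φ) z).comp (ContinuousLinearMap.inr ℝ P (Rn n)) =
        (chartDeriv p (Φ z)).comp (mfderiv (𝓡 n) (𝓡 n) (φ.toFun (F z.1)) z.2) := by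
      ext1 v
      refine (hd z hz (0, v)).trans ?_
      exact congrArg (chartDeriv p (Φ z)) (φ.mfderiv_comp_inr hF z.1 z.2 v)
    rw [h1]
    refine ContinuousLinearMap.IsInvertible.comp ?_ hinv
    have h2 := chartDeriv_comp_chartSymmDeriv p (e.map_source hz)
    rw [e.left_inv hz] at h2
    exact ContinuousLinearMap.IsInvertible.of_inverse h2 (chartSymmDeriv_comp_chartDeriv p hz)
  · rw [hd z hz, hd z hz]
    refine congrArg (chartDeriv p (Φ z)) ?_
    refine (φ.mfderiv_comp_inr hF z.1 z.2 _).trans (Eq.trans ?_ (φ.mfderiv_comp_inl hF _ _ _).symm)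
    exact hinv.self_apply_inverse _
  · have h3 := chartRep_apply p A (e.map_source hz)
    rw [e.left_inv hz] at h3
    rw [hd z hz]
    refine Eq.trans ?_ h3.symm
    refine congrArg (chartDeriv p (Φ z)) ?_
    refine (φ.mfderiv_comp_inr hF z.1 z.2 _).trans ?_
    exact hinv.self_apply_inverse _

theorem contDiffOn_inverse {N : Set (P × Rn n)} {Ψ : P × Rn n → Rn n} (hN : IsOpen N)
    (hΨ : ContDiffOn ℝ ∞ Ψ N)
    (h : ∀ z ∈ N, ((fderiv ℝ Ψ z).comp (ContinuousLinearMap.inr ℝ P (Rn n))).IsInvertible) :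
    ContDiffOn ℝ ∞ (fun z =>
      ((fderiv ℝ Ψ z).comp (ContinuousLinearMap.inr ℝ P (Rn n))).inverse) N := by
  intro z hz
  have h1 : ContDiffOn ℝ ∞ (fderiv ℝ Ψ) N := hΨ.fderiv_of_isOpen hN (by simp)
  have h2 : ContDiffWithinAt ℝ ∞ (fun z =>
      (fderiv ℝ Ψ z).comp (ContinuousLinearMap.inr ℝ P (Rn n))) N z :=
    (h1 z hz).clm_comp contDiffWithinAt_const
  exact ContDiffAt.comp_contDiffWithinAt (g := ContinuousLinearMap.inverse) z
    ((h z hz).contDiffAt_map_inverse) h2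

theorem eq_inverse_apply {Ψ : P × Rn n → Rn n} {z : P × Rn n}
    (h : ((fderiv ℝ Ψ z).comp (ContinuousLinearMap.inr ℝ P (Rn n))).IsInvertible) {x y : Rn n}
    (hxy : fderiv ℝ Ψ z (0, x) = y) :
    x = ((fderiv ℝ Ψ z).comp (ContinuousLinearMap.inr ℝ P (Rn n))).inverse y := by
  rw [← hxy]
  exact (h.inverse_apply_self x).symm

/-- In a chart the field is the inverse of the fibre derivative of Ψ applied to the derivative of Ψ
in the direction w; both factors are smooth in (t, u). -/
theorem isSmoothFamily_along (hF : ContMDiff 𝓘(ℝ, P) (𝓡 n) ∞ F) (w : P) :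
    IsSmoothFamily (φ.along F w) := by
  refine contDiff_iff_contDiffAt.2 fun z₀ => ?_
  obtain ⟨p, N, Ψ, hN, hz₀, hΨ, h⟩ := φ.exists_local_form hF z₀
  have h1 := contDiffOn_inverse hN hΨ fun z hz => (h z hz).2.1
  have h2 : ContDiffOn ℝ ∞ (fderiv ℝ Ψ) N := hΨ.fderiv_of_isOpen hN (by simp)
  have h3 := h1.clm_apply (h2.clm_apply (contDiffOn_const (c := ((w, 0) : P × Rn n))))
  refine ((h3 z₀ hz₀).contDiffAt (hN.mem_nhds hz₀)).congr_of_eventuallyEq ?_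
  filter_upwards [hN.mem_nhds hz₀] with z hz
  exact eq_inverse_apply (h z hz).2.1 ((h z hz).2.2.1 w)

theorem isSmoothFamily_pull (hF : ContMDiff 𝓘(ℝ, P) (𝓡 n) ∞ F) (A : Vect n M) :
    IsSmoothFamily fun t => φ.pull (F t) A := by
  refine contDiff_iff_contDiffAt.2 fun z₀ => ?_
  obtain ⟨p, N, Ψ, hN, hz₀, hΨ, h⟩ := φ.exists_local_form hF z₀
  have h1 := contDiffOn_inverse hN hΨ fun z hz => (h z hz).2.1
  have h2 : ContDiffOn ℝ ∞ (fun z => chartRep p A (Ψ z)) N := fun z hz =>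
    ContDiffAt.comp_contDiffWithinAt z (contDiffAt_chartRep p A (h z hz).1) (hΨ z hz)
  have h3 := h1.clm_apply h2
  refine ((h3 z₀ hz₀).contDiffAt (hN.mem_nhds hz₀)).congr_of_eventuallyEq ?_
  filter_upwards [hN.mem_nhds hz₀] with z hz
  exact eq_inverse_apply (h z hz).2.1 ((h z hz).2.2.2 A)

/-- The pull-back of vector fields is jointly continuous in the vector field and the point. -/
theorem continuous_pull (hF : ContMDiff 𝓘(ℝ, P) (𝓡 n) ∞ F) :
    Continuous fun q : P × Vect n M => φ.pull (F q.1) q.2 := by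
  refine continuous_of_familyCk fun k => familyCk_univ_of_local fun q => ?_
  obtain ⟨p, N, Ψ, hN, hz₀, hΨ, h⟩ := φ.exists_local_form hF (q.1.1, q.2)
  have h1 := contDiffOn_inverse hN hΨ fun z hz => (h z hz).2.1
  let S : Set ((P × Vect n M) × Rn n) := {r | (r.1.1, r.2) ∈ N}
  have hS : IsOpen S := hN.preimage (by fun_prop)
  have f1 : FamilyCk S k fun (r : P × Vect n M) u =>
      ((fderiv ℝ Ψ (r.1, u)).comp (ContinuousLinearMap.inr ℝ P (Rn n))).inverse :=
    (FamilyCk.of_contDiffOn hN h1 k).comp_param continuous_fst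
  have f2 : FamilyCk S k fun (r : P × Vect n M) u => Ψ (r.1, u) :=
    (FamilyCk.of_contDiffOn hN hΨ k).comp_param continuous_fst
  have f3 := (familyCk_chartRep (n := n) p k).comp_param (Y := P × Vect n M) continuous_snd
  have f4 := FamilyCk.comp f3 f2 fun r hr => ⟨Set.mem_univ _, (h _ hr).1⟩
  have f5 := FamilyCk.bilinear (ContinuousLinearMap.id ℝ (Rn n →L[ℝ] Rn n)) f1 f4
  refine ⟨S, hS, hz₀, f5.congr hS fun r hr => ?_⟩
  exact (eq_inverse_apply (h _ hr).2.1 ((h _ hr).2.2.2 r.1.2)).symm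

theorem hasFDerivAt_inr_of_isSmoothFamily {B : P → W n} (hB : IsSmoothFamily B) (t : P)
    (u v : Rn n) : fderiv ℝ (fun z : P × Rn n => (B z.1 z.2 : Rn n)) (t, u) (0, v) =
      fderiv ℝ (fun u => (B t u : Rn n)) u v := by
  have h := ((ContDiff.differentiable hB (by simp)) (t, u)).hasFDerivAt
  exact (DFunLike.congr_fun (h.comp u (hasFDerivAt_prodMk_right t u)).fderiv v).symm

/-- Moving the base point changes the coordinate system infinitesimally by the flow of t_w, so the
pulled-back field changes by a Lie derivative. In a chart this is `fderiv_inl_of_related`. -/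
theorem deriv_pull (hF : ContMDiff 𝓘(ℝ, P) (𝓡 n) ∞ F) (A : Vect n M) (w t : P) :
    (φ.isSmoothFamily_pull hF A).deriv w t = ⁅φ.along F w t, φ.pull (F t) A⁆ := by
  ext u : 1
  obtain ⟨p, N, Ψ, hN, hz₀, hΨ, h⟩ := φ.exists_local_form hF (t, u)
  have hB := φ.isSmoothFamily_pull hF A
  have hT := φ.isSmoothFamily_along hF w
  have dB := ((ContDiff.differentiable hB (by simp)) (t, u))
  have dT := ((ContDiff.differentiable hT (by simp)) (t, u))
  have key := fderiv_inl_of_related (hΨ.contDiffAt (hN.mem_nhds hz₀)) (h _ hz₀).2.1 dT dB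
    ((contDiffAt_chartRep p A (h _ hz₀).1).differentiableAt (by simp))
    (by filter_upwards [hN.mem_nhds hz₀] with z hz using (h z hz).2.2.1 w)
    (by filter_upwards [hN.mem_nhds hz₀] with z hz using (h z hz).2.2.2 A)
  refine key.trans ((congrArg₂ (· - ·) ?_ ?_).trans (W.lie_apply _ _ u).symm)
  · exact hasFDerivAt_inr_of_isSmoothFamily hB t u _
  · exact hasFDerivAt_inr_of_isSmoothFamily hT t u _

/-- The Maurer–Cartan equation for the 1-form v ↦ t_v, evaluated on the constant, hence commuting,
fields w and w'. -/
theorem deriv_along_sub_deriv_along (hF : ContMDiff 𝓘(ℝ, P) (𝓡 n) ∞ F) (w w' t : P) :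
    (φ.isSmoothFamily_along hF w').deriv w t - (φ.isSmoothFamily_along hF w).deriv w' t =
      ⁅φ.along F w t, φ.along F w' t⁆ := by
  ext u : 1
  obtain ⟨p, N, Ψ, hN, hz₀, hΨ, h⟩ := φ.exists_local_form hF (t, u)
  have hT := φ.isSmoothFamily_along hF
  have dT := fun w => ((ContDiff.differentiable (hT w) (by simp)) (t, u))
  have hX : ∀ w, ∀ᶠ z in 𝓝 (t, u),
      fderiv ℝ Ψ z (0, (φ.along F w z.1 z.2 : Rn n)) = fderiv ℝ Ψ z (w, 0) := by
    intro w
    filter_upwards [hN.mem_nhds hz₀] with z hz using (h z hz).2.2.1 w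
  have key := fderiv_inl_sub_fderiv_inl (hΨ.contDiffAt (hN.mem_nhds hz₀)) (h _ hz₀).2.1 (dT w)
    (dT w') (hX w) (hX w')
  refine key.trans ((congrArg₂ (· - ·) ?_ ?_).trans (W.lie_apply _ _ u).symm)
  · exact hasFDerivAt_inr_of_isSmoothFamily (hT w') t u _
  · exact hasFDerivAt_inr_of_isSmoothFamily (hT w) t u _

end CoordFamily

end Coordinates

/-! ### Stokes' theorem on the solid simplex -/

section SolidSimplex

open MeasureTheory

theorem sum_simplexParam {l : ℕ} (t : Fin l → ℝ) : ∑ i, simplexParam l t i = 1 := by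
  simp [simplexParam, Fin.sum_univ_succ]

theorem mem_solidSimplex {l : ℕ} {t : Fin l → ℝ} :
    t ∈ solidSimplex l ↔ (∀ i, 0 ≤ t i) ∧ ∑ i, t i ≤ 1 := by
  have h : simplexParam l t ∈ stdSimplex ℝ (Fin (l + 1)) ↔
      (∀ i, 0 ≤ simplexParam l t i) ∧ ∑ i, simplexParam l t i = 1 := Iff.rfl
  change simplexParam l t ∈ stdSimplex ℝ (Fin (l + 1)) ↔ _
  rw [h, sum_simplexParam, Fin.forall_fin_succ]
  simp [simplexParam, and_comm]

theorem contDiff_simplexParam (l : ℕ) : ContDiff ℝ ∞ (simplexParam l) := by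
  rw [contDiff_pi]
  intro i
  refine Fin.cases ?_ (fun j => ?_) i
  · simp only [simplexParam, Fin.cons_zero]; fun_prop
  · simp only [simplexParam, Fin.cons_succ]; fun_prop

theorem isClosed_solidSimplex (l : ℕ) : IsClosed (solidSimplex l) :=
  (isClosed_stdSimplex ℝ (Fin (l + 1))).preimage (contDiff_simplexParam l).continuous

theorem isCompact_solidSimplex (l : ℕ) : IsCompact (solidSimplex l) := by
  refine Metric.isCompact_of_isClosed_isBounded (isClosed_solidSimplex l) ?_
  refine (Metric.isBounded_Icc (0 : Fin l → ℝ) 1).subset fun t ht => ?_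
  rw [mem_solidSimplex] at ht
  refine ⟨fun i => ht.1 i, fun i => ?_⟩
  exact (Finset.single_le_sum (fun j _ => ht.1 j) (Finset.mem_univ i)).trans ht.2

theorem measurableSet_solidSimplex (l : ℕ) : MeasurableSet (solidSimplex l) :=
  (isClosed_solidSimplex l).measurableSet

theorem zero_mem_solidSimplex (l : ℕ) : (0 : Fin l → ℝ) ∈ solidSimplex l := by
  rw [mem_solidSimplex]; simp

theorem convex_solidSimplex (l : ℕ) : Convex ℝ (solidSimplex l) := by
  intro x hx y hy a b ha hb hab
  rw [mem_solidSimplex] at *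
  refine ⟨fun i => ?_, ?_⟩
  · have := hx.1 i; have := hy.1 i
    simp only [Pi.add_apply, Pi.smul_apply, smul_eq_mul]; positivity
  · simp only [Pi.add_apply, Pi.smul_apply, smul_eq_mul, Finset.sum_add_distrib, ← Finset.mul_sum]
    nlinarith [hx.2, hy.2]

theorem interior_solidSimplex_nonempty (l : ℕ) : (interior (solidSimplex l)).Nonempty := by
  -- The barycentre: all `l + 1` barycentric coordinates are equal and positive.
  refine ⟨fun _ => 1 / (l + 1), mem_interior.2 ⟨{t | (∀ i, 0 < t i) ∧ ∑ i, t i < 1}, ?_, ?_, ?_⟩⟩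
  · intro t ht
    exact mem_solidSimplex.2 ⟨fun i => (ht.1 i).le, ht.2.le⟩
  · refine IsOpen.inter ?_ (isOpen_lt (f := fun t : Fin l → ℝ => ∑ i, t i) (by fun_prop)
      continuous_const)
    have : {t : Fin l → ℝ | ∀ i, 0 < t i} = ⋂ i, {t | 0 < t i} := by ext; simp
    change IsOpen {t : Fin l → ℝ | ∀ i, 0 < t i}
    rw [this]
    exact isOpen_iInter_of_finite fun i => isOpen_lt continuous_const (continuous_apply i)
  · refine ⟨fun i => by positivity, ?_⟩
    simp only [Finset.sum_const, Finset.card_univ, Fintype.card_fin, nsmul_eq_mul]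
    rw [mul_one_div, div_lt_one (by positivity)]
    linarith

theorem uniqueDiffOn_solidSimplex (l : ℕ) : UniqueDiffOn ℝ (solidSimplex l) :=
  uniqueDiffOn_convex (convex_solidSimplex l) (interior_solidSimplex_nonempty l)

theorem integrableOn_solidSimplex {l : ℕ} {f : (Fin l → ℝ) → ℂ} (hf : Continuous f) :
    IntegrableOn f (solidSimplex l) :=
  hf.continuousOn.integrableOn_compact (isCompact_solidSimplex l)

theorem insertNth_mem_solidSimplex {p : ℕ} (j : Fin (p + 1)) (s : ℝ) (t : Fin p → ℝ) :
    (j.insertNth s t : Fin (p + 1) → ℝ) ∈ solidSimplex (p + 1) ↔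
      t ∈ solidSimplex p ∧ s ∈ Set.Icc 0 (1 - ∑ i, t i) := by
  rw [mem_solidSimplex, mem_solidSimplex, Fin.forall_iff_succAbove j, Fin.sum_univ_succAbove _ j]
  simp only [Fin.insertNth_apply_same, Fin.insertNth_apply_succAbove, Set.mem_Icc]
  constructor
  · rintro ⟨⟨h1, h2⟩, h3⟩
    exact ⟨⟨h2, by linarith⟩, h1, by linarith⟩
  · rintro ⟨⟨h2, h3⟩, h1, h4⟩
    exact ⟨⟨h1, h2⟩, by linarith⟩

theorem insertNth_eq_add_smul {p : ℕ} (j : Fin (p + 1)) (s s₀ : ℝ) (t : Fin p → ℝ) :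
    (j.insertNth s t : Fin (p + 1) → ℝ) =
      j.insertNth s₀ t + (s - s₀) • (Pi.single j (1 : ℝ) : Fin (p + 1) → ℝ) := by
  funext i
  refine Fin.succAboveCases j ?_ (fun i => ?_) i
  · simp
  · simp [Fin.succAbove_ne]

theorem continuous_insertNth {p : ℕ} (j : Fin (p + 1)) :
    Continuous fun q : ℝ × (Fin p → ℝ) => (j.insertNth q.1 q.2 : Fin (p + 1) → ℝ) :=
  Continuous.finInsertNth j continuous_fst continuous_snd

/-- The fundamental theorem of calculus in the direction of a coordinate vector, on the solid
simplex. -/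
theorem setIntegral_partialDeriv {p : ℕ} (j : Fin (p + 1)) {f g : (Fin (p + 1) → ℝ) → ℂ}
    (hg : Continuous g)
    (hfg : ∀ t, HasDerivAt (fun s : ℝ => f (t + s • (Pi.single j (1 : ℝ) : Fin (p + 1) → ℝ)))
      (g t) 0) :
    ∫ t in solidSimplex (p + 1), g t = ∫ t in solidSimplex p,
      (f (j.insertNth (1 - ∑ i, t i) t) - f (j.insertNth 0 t)) := by
  let e := (MeasurableEquiv.piFinSuccAbove (fun _ : Fin (p + 1) => ℝ) j).symm
  have he : MeasurePreserving e := (volume_preserving_piFinSuccAbove (fun _ => ℝ) j).symm _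
  have heq : ∀ q : ℝ × (Fin p → ℝ), e q = j.insertNth q.1 q.2 := fun q => rfl
  let S : Set (ℝ × (Fin p → ℝ)) := e ⁻¹' solidSimplex (p + 1)
  have hS : MeasurableSet S := e.measurable (measurableSet_solidSimplex _)
  have h1 : ∫ t in solidSimplex (p + 1), g t = ∫ q in S, g (e q) :=
    (he.setIntegral_preimage_emb e.measurableEmbedding g _).symm
  have hint : IntegrableOn (fun q => g (e q)) S :=
    (he.integrableOn_comp_preimage e.measurableEmbedding).2 (integrableOn_solidSimplex hg)
  rw [h1, ← integral_indicator hS, Measure.volume_eq_prod, integral_prod_symm _ (by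
    rw [← Measure.volume_eq_prod]; exact hint.integrable_indicator hS),
    ← integral_indicator (measurableSet_solidSimplex p)]
  congr 1
  funext t
  by_cases ht : t ∈ solidSimplex p
  · rw [Set.indicator_of_mem ht]
    have h0 : 0 ≤ 1 - ∑ i, t i := by have := (mem_solidSimplex.1 ht).2; linarith
    have h2 : (fun s : ℝ => S.indicator (fun q => g (e q)) (s, t)) =
        (Set.Icc 0 (1 - ∑ i, t i)).indicator fun s => g (j.insertNth s t) := by
      funext s
      by_cases hs : s ∈ Set.Icc 0 (1 - ∑ i, t i)
      · rw [Set.indicator_of_mem hs, Set.indicator_of_mem]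
        · rfl
        · exact (insertNth_mem_solidSimplex j s t).2 ⟨ht, hs⟩
      · rw [Set.indicator_of_notMem hs, Set.indicator_of_notMem]
        exact fun h => hs ((insertNth_mem_solidSimplex j s t).1 h).2
    rw [h2, integral_indicator measurableSet_Icc, integral_Icc_eq_integral_Ioc,
      ← intervalIntegral.integral_of_le h0]
    refine intervalIntegral.integral_eq_sub_of_hasDerivAt (f := fun s => f (j.insertNth s t))
      (fun s₀ _ => ?_) (Continuous.intervalIntegrable ?_ _ _)
    · have h3 := hfg (j.insertNth s₀ t)
      -- The derivative is known at parameter 0; writing 0 as s₀ − s₀ lets a translation carry it to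
      -- s₀.
      rw [← sub_self s₀] at h3
      have h4 := h3.comp_sub_const s₀ s₀
      refine h4.congr_of_eventuallyEq (Filter.Eventually.of_forall fun s => ?_)
      exact congrArg f (insertNth_eq_add_smul j s s₀ t)
    · exact hg.comp ((continuous_insertNth j).comp (Continuous.prodMk_left t))
  · rw [Set.indicator_of_notMem ht]
    have h2 : (fun s : ℝ => S.indicator (fun q => g (e q)) (s, t)) = 0 := by
      funext s
      rw [Set.indicator_of_notMem]
      · rfl
      · exact fun h => ht ((insertNth_mem_solidSimplex j s t).1 h).1
    rw [h2]
    exact integral_zero _ _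

/-- The affine transformation of `ℝ^p` which moves the omitted barycentric coordinate from the
place `b` to the place `a`. -/
def moveCoord {p : ℕ} (a b : Fin (p + 1)) (t : Fin p → ℝ) : Fin p → ℝ :=
  a.removeNth (b.insertNth (1 - ∑ i, t i) t : Fin (p + 1) → ℝ)

theorem insertNth_moveCoord {p : ℕ} (a b : Fin (p + 1)) (t : Fin p → ℝ) :
    (a.insertNth (1 - ∑ i, moveCoord a b t i) (moveCoord a b t) : Fin (p + 1) → ℝ) =
      b.insertNth (1 - ∑ i, t i) t := by
  set x : Fin (p + 1) → ℝ := b.insertNth (1 - ∑ i, t i) t with hx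
  have h1 : ∑ i, x i = 1 := by
    rw [Fin.sum_univ_succAbove _ b]
    simp [hx]
  have h2 : 1 - ∑ i, moveCoord a b t i = x a := by
    rw [Fin.sum_univ_succAbove _ a] at h1
    change 1 - ∑ i, x (a.succAbove i) = x a
    linarith
  rw [h2]
  exact Fin.insertNth_self_removeNth a x

theorem moveCoord_moveCoord {p : ℕ} (a b : Fin (p + 1)) (t : Fin p → ℝ) :
    moveCoord b a (moveCoord a b t) = t := by
  rw [moveCoord, insertNth_moveCoord]
  exact Fin.removeNth_insertNth _ _ _

theorem moveCoord_mem {p : ℕ} (a b : Fin (p + 1)) {t : Fin p → ℝ} (ht : t ∈ solidSimplex p) :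
    moveCoord a b t ∈ solidSimplex p := by
  have h0 : 0 ≤ 1 - ∑ i, t i := by have := (mem_solidSimplex.1 ht).2; linarith
  have h1 := (insertNth_mem_solidSimplex b (1 - ∑ i, t i) t).2 ⟨ht, h0, le_rfl⟩
  rw [← insertNth_moveCoord a b t] at h1
  exact ((insertNth_mem_solidSimplex _ _ _).1 h1).1

/-- The linear part of `moveCoord`. -/
def moveCoordLinear {p : ℕ} (a b : Fin (p + 1)) : (Fin p → ℝ) →ₗ[ℝ] (Fin p → ℝ) where
  toFun t := a.removeNth (b.insertNth (-∑ i, t i) t : Fin (p + 1) → ℝ)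
  map_add' s t := by
    funext i
    simp only [Fin.removeNth, Pi.add_apply]
    refine Fin.succAboveCases b ?_ (fun k => ?_) (a.succAbove i)
    · simp [Finset.sum_add_distrib]; ring
    · simp
  map_smul' c t := by
    funext i
    simp only [Fin.removeNth, Pi.smul_apply, RingHom.id_apply]
    refine Fin.succAboveCases b ?_ (fun k => ?_) (a.succAbove i)
    · simp [Finset.mul_sum]
    · simp

theorem moveCoord_eq {p : ℕ} (a b : Fin (p + 1)) (t : Fin p → ℝ) :
    moveCoord a b t = moveCoord a b 0 + moveCoordLinear a b t := by
  funext i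
  simp only [moveCoord, moveCoordLinear, LinearMap.coe_mk, AddHom.coe_mk, Fin.removeNth,
    Pi.add_apply]
  refine Fin.succAboveCases b ?_ (fun k => ?_) (a.succAbove i)
  · simp; ring
  · simp

/-- An affine bijection of the simplex onto itself preserves its volume, which is finite and
positive, so its determinant has absolute value 1 without being computed. -/
theorem setIntegral_comp_moveCoord {p : ℕ} (a b : Fin (p + 1)) (q : (Fin p → ℝ) → ℂ) :
    ∫ t in solidSimplex p, q (moveCoord a b t) = ∫ t in solidSimplex p, q t := by
  let L := LinearMap.toContinuousLinearMap (moveCoordLinear a b)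
  have hd : ∀ t ∈ solidSimplex p,
      HasFDerivWithinAt (moveCoord a b) L (solidSimplex p) t := by
    intro t _
    have h : moveCoord a b = fun t => moveCoord a b 0 + L t := funext (moveCoord_eq a b)
    rw [h]
    exact (L.hasFDerivAt.const_add _).hasFDerivWithinAt
  have hinj : Set.InjOn (moveCoord a b) (solidSimplex p) :=
    (Function.LeftInverse.injective (moveCoord_moveCoord a b)).injOn
  have himg : moveCoord a b '' solidSimplex p = solidSimplex p := by
    refine Set.Subset.antisymm ?_ fun t ht => ?_
    · rintro _ ⟨t, ht, rfl⟩
      exact moveCoord_mem a b ht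
    · exact ⟨moveCoord b a t, moveCoord_mem b a ht, moveCoord_moveCoord b a t⟩
  have hdet : |L.det| = 1 := by
    have h1 := integral_image_eq_integral_abs_det_fderiv_smul volume
      (measurableSet_solidSimplex p) hd hinj (fun _ => (1 : ℝ))
    rw [himg] at h1
    simp only [integral_const, smul_eq_mul, mul_one] at h1
    have h2 : 0 < (volume.restrict (solidSimplex p)).real Set.univ := by
      rw [measureReal_restrict_apply_univ, measureReal_def]
      refine ENNReal.toReal_pos ?_ (isCompact_solidSimplex p).measure_lt_top.ne
      exact (Measure.measure_pos_of_nonempty_interior _ (interior_solidSimplex_nonempty p)).ne'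
    have h3 := mul_left_cancel₀ h2.ne' ((mul_one _).trans h1)
    exact h3.symm
  have h := integral_image_eq_integral_abs_det_fderiv_smul volume
    (measurableSet_solidSimplex p) hd hinj q
  rw [himg, hdet] at h
  simpa using h.symm

/-- The `i`-th face of the solid simplex. -/
def faceMap {p : ℕ} (i : Fin (p + 2)) (t : Fin p → ℝ) : Fin (p + 1) → ℝ :=
  Fin.tail (i.insertNth 0 (simplexParam p t) : Fin (p + 2) → ℝ)

theorem faceMap_zero {p : ℕ} (t : Fin p → ℝ) :
    faceMap 0 t = (0 : Fin (p + 1)).insertNth (1 - ∑ i, t i) t := by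
  simp [faceMap, simplexParam]

theorem faceMap_succ {p : ℕ} (j : Fin (p + 1)) (t : Fin p → ℝ) :
    faceMap j.succ t = j.insertNth 0 t := by
  funext i
  simp only [faceMap, Fin.tail]
  refine Fin.succAboveCases j ?_ (fun k => ?_) i
  · simp
  · rw [← Fin.succ_succAbove_succ]
    simp [simplexParam]

theorem simplexParam_faceMap {p : ℕ} (i : Fin (p + 2)) (t : Fin p → ℝ) :
    simplexParam (p + 1) (faceMap i t) = i.insertNth 0 (simplexParam p t) := by
  set x : Fin (p + 2) → ℝ := i.insertNth 0 (simplexParam p t) with hx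
  have h1 : ∑ k, x k = 1 := by
    rw [Fin.sum_univ_succAbove _ i]
    simp [hx, sum_simplexParam]
  have h2 : 1 - ∑ k, faceMap i t k = x 0 := by
    rw [Fin.sum_univ_succ] at h1
    change 1 - ∑ k : Fin (p + 1), x k.succ = x 0
    linarith
  rw [simplexParam, h2]
  exact Fin.cons_self_tail x

/-- The differential of `faceMap i` applied to the `r`-th coordinate vector. -/
def faceVec {p : ℕ} (i : Fin (p + 2)) (r : Fin p) : Fin (p + 1) → ℝ :=
  Fin.cases ((Pi.single r.succ 1 : Fin (p + 1) → ℝ) - Pi.single 0 1)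
    (fun j => Pi.single (j.succAbove r) 1) i

theorem faceMap_add_smul {p : ℕ} (i : Fin (p + 2)) (r : Fin p) (t : Fin p → ℝ) (s : ℝ) :
    faceMap i (t + s • (Pi.single r (1 : ℝ) : Fin p → ℝ)) = faceMap i t + s • faceVec i r := by
  refine Fin.cases ?_ (fun j => ?_) i
  · rw [faceMap_zero, faceMap_zero]
    funext k
    refine Fin.cases ?_ (fun k => ?_) k
    · simp [faceVec, Finset.sum_add_distrib, ← Finset.mul_sum]
      ring
    · simp [faceVec, Pi.single_apply]
  · rw [faceMap_succ, faceMap_succ]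
    funext k
    refine Fin.succAboveCases j ?_ (fun k => ?_) k
    · simp [faceVec, (Fin.succAbove_ne j r).symm]
    · simp [faceVec, Pi.single_apply]

theorem contDiff_faceMap {p : ℕ} (i : Fin (p + 2)) : ContDiff ℝ ∞ (faceMap (p := p) i) := by
  rw [contDiff_pi]
  refine Fin.cases ?_ (fun j => ?_) i
  · intro k
    simp only [faceMap_zero]
    refine Fin.cases ?_ (fun k => ?_) k
    · simp only [Fin.insertNth_zero', Fin.cons_zero]; fun_prop
    · simp only [Fin.insertNth_zero', Fin.cons_succ]; fun_prop
  · intro k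
    simp only [faceMap_succ]
    refine Fin.succAboveCases j ?_ (fun k => ?_) k
    · simp only [Fin.insertNth_apply_same]; fun_prop
    · simp only [Fin.insertNth_apply_succAbove]; fun_prop

theorem fderiv_faceMap {p : ℕ} (i : Fin (p + 2)) (r : Fin p) (t : Fin p → ℝ) :
    fderiv ℝ (faceMap i) t (Pi.single r 1) = faceVec i r := by
  rw [← ((contDiff_faceMap i).differentiable (by simp) t).lineDeriv_eq_fderiv]
  refine HasLineDerivAt.lineDeriv ?_
  have h : (fun s : ℝ => faceMap i (t + s • (Pi.single r (1 : ℝ) : Fin p → ℝ))) =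
      fun s => faceMap i t + s • faceVec i r := funext (faceMap_add_smul i r t)
  rw [HasLineDerivAt, h]
  simpa using ((hasDerivAt_id (0 : ℝ)).smul_const (faceVec i r)).const_add (faceMap i t)

/-- In the multilinear expansion every term containing `e 0` twice vanishes; moving a single `e 0`
to the front gives the sign. It is applied to the slanted face, whose tangent vectors are the
differences e_{r+1} − e_0. -/
theorem map_sub_eq_sum {V : Type*} [AddCommGroup V] [Module ℝ V] {p : ℕ}
    (f : V [⋀^Fin p]→ₗ[ℝ] ℂ) (e : Fin (p + 1) → V) :
    f (fun r => e r.succ - e 0) =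
      ∑ j : Fin (p + 1), (-1 : ℂ) ^ (j : ℕ) * f (fun r => e (j.succAbove r)) := by
  have h := f.toMultilinearMap.map_add_eq_map_add_linearDeriv_add (fun r => e r.succ)
    (fun _ => -e 0)
  have h0 : ∑ s : Finset (Fin p) with 2 ≤ s.card,
      f.toMultilinearMap (s.piecewise (fun _ => -e 0) fun r => e r.succ) = 0 := by
    refine Finset.sum_eq_zero fun s hs => ?_
    obtain ⟨a, ha, b, hb, hab⟩ := Finset.one_lt_card.1 (Finset.mem_filter.1 hs).2
    exact f.map_eq_zero_of_eq _ (by simp [ha, hb]) hab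
  rw [h0, add_zero, MultilinearMap.linearDeriv_apply] at h
  have h1 : f (fun r => e r.succ - e 0) = f (fun r => e r.succ) +
      ∑ i, f (Function.update (fun r => e r.succ) i (-e 0)) := by
    simp only [sub_eq_add_neg]; exact h
  rw [h1, Fin.sum_univ_succ]
  congr 1
  · simp
  · cases p with
    | zero => simp
    | succ k =>
      refine Finset.sum_congr rfl fun i _ => ?_
      have h2 : (fun r => e (i.succ.succAbove r)) =
          Fin.cons (e 0) (fun r => e (i.succAbove r).succ) := by
        funext r
        refine Fin.cases ?_ (fun r => ?_) r
        · simp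
        · simp
      have h3 : f (Function.update (fun r => e r.succ) i (-e 0)) =
          - f (Function.update (fun r => e r.succ) i (e 0)) := f.map_update_neg _ _ _
      rw [h2, h3, map_update_eq_cons, Fin.val_succ, pow_succ]
      ring

/-- **Stokes' theorem** for a simplex, in terms of the coefficients of the form and of their
partial derivatives. -/
theorem stokes_solidSimplex {p : ℕ}
    (θ : (Fin (p + 1) → ℝ) → (Fin (p + 1) → ℝ) [⋀^Fin p]→ₗ[ℝ] ℂ)
    (g : Fin (p + 1) → (Fin (p + 1) → ℝ) → ℂ)
    (hθ : ∀ j : Fin (p + 1), Continuous fun t => θ t (fun r => Pi.single (j.succAbove r) 1))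
    (hg : ∀ j, Continuous (g j))
    (hd : ∀ j t, HasDerivAt (fun s : ℝ => θ (t + s • (Pi.single j (1 : ℝ) : Fin (p + 1) → ℝ))
      (fun r => Pi.single (j.succAbove r) 1)) (g j t) 0) :
    ∑ i : Fin (p + 2), (-1 : ℂ) ^ (i : ℕ) *
        ∫ t in solidSimplex p, θ (faceMap i t) (faceVec i) =
      ∫ t in solidSimplex (p + 1), ∑ j : Fin (p + 1), (-1 : ℂ) ^ (j : ℕ) * g j t := by
  let f : Fin (p + 1) → (Fin (p + 1) → ℝ) → ℂ :=
    fun j t => θ t (fun r => Pi.single (j.succAbove r) 1)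
  have hcu : ∀ (j k : Fin (p + 1)), Continuous fun t : Fin p → ℝ =>
      f j (k.insertNth (1 - ∑ i, t i) t) := fun j k =>
    (hθ j).comp ((continuous_insertNth k).comp (Continuous.prodMk (by fun_prop) continuous_id))
  have hcl : ∀ j : Fin (p + 1), Continuous fun t : Fin p → ℝ => f j (j.insertNth 0 t) := fun j =>
    (hθ j).comp ((continuous_insertNth j).comp (Continuous.prodMk continuous_const continuous_id))
  -- The slanted face carries all coefficients of the form. Each `f j` is reparametrized so that the
  -- face becomes a graph over the coordinates other than j, which is where integration in the
  -- direction j meets it.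
  have e0 : ∫ t in solidSimplex p, θ (faceMap 0 t) (faceVec 0) =
      ∑ j : Fin (p + 1), (-1 : ℂ) ^ (j : ℕ) *
        ∫ t in solidSimplex p, f j (j.insertNth (1 - ∑ i, t i) t) := by
    have h1 : ∀ t : Fin p → ℝ, θ (faceMap 0 t) (faceVec 0) =
        ∑ j : Fin (p + 1), (-1 : ℂ) ^ (j : ℕ) *
          f j ((0 : Fin (p + 1)).insertNth (1 - ∑ i, t i) t) := by
      intro t
      rw [faceMap_zero]
      exact map_sub_eq_sum _ (fun r => (Pi.single r 1 : Fin (p + 1) → ℝ))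
    simp only [h1]
    rw [integral_finsetSum _ fun j _ =>
      ((integrableOn_solidSimplex (hcu j 0)).integrable.const_mul _)]
    refine Finset.sum_congr rfl fun j _ => ?_
    rw [integral_const_mul, ← setIntegral_comp_moveCoord j 0
      (fun t => f j (j.insertNth (1 - ∑ i, t i) t))]
    simp only [insertNth_moveCoord]
  have e1 : ∀ j : Fin (p + 1), ∫ t in solidSimplex p, θ (faceMap j.succ t) (faceVec j.succ) =
      ∫ t in solidSimplex p, f j (j.insertNth 0 t) := by
    intro j
    congr 1
    funext t
    rw [faceMap_succ]
    rfl
  rw [integral_finsetSum _ fun j _ =>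
      ((integrableOn_solidSimplex (hg j)).integrable.const_mul _), Fin.sum_univ_succ, e0]
  simp only [e1, Fin.val_zero, pow_zero, one_mul]
  rw [← Finset.sum_add_distrib]
  refine Finset.sum_congr rfl fun j _ => ?_
  -- The upper endpoint of the line in direction j lies on the slanted face. The lower one lies on
  -- face `j.succ`, whose boundary sign (−1)^{j+1} matches the minus sign of the fundamental
  -- theorem.
  rw [integral_const_mul, setIntegral_partialDeriv j (f := f j) (hg j) (hd j),
    integral_sub (integrableOn_solidSimplex (hcu j j)) (integrableOn_solidSimplex (hcl j)),
    Fin.val_succ, pow_succ]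
  ring

end SolidSimplex

/-! ### Alternating forms with a block of arguments frozen -/

section AppendUpdate

theorem append_update_left {α : Type*} {l m : ℕ} (T : Fin l → α) (A : Fin m → α) (i : Fin l)
    (x : α) : Fin.append (Function.update T i x) A =
      Function.update (Fin.append T A) (Fin.castAdd m i) x := by
  funext r
  refine Fin.addCases (fun r => ?_) (fun r => ?_) r
  · by_cases h : r = i
    · subst h; simp
    · rw [Function.update_of_ne (by simpa using h)]
      simp [h]
  · rw [Function.update_of_ne (by simp [Fin.ext_iff]; omega)]
    simp

theorem append_update_right {α : Type*} {l m : ℕ} (T : Fin l → α) (A : Fin m → α) (i : Fin m)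
    (x : α) : Fin.append T (Function.update A i x) =
      Function.update (Fin.append T A) (Fin.natAdd l i) x := by
  funext r
  refine Fin.addCases (fun r => ?_) (fun r => ?_) r
  · rw [Function.update_of_ne (by simp [Fin.ext_iff]; omega)]
    simp
  · by_cases h : r = i
    · subst h; simp
    · rw [Function.update_of_ne (by simpa using h)]
      simp [h]

theorem append_apply {ι α : Type*} {l m : ℕ} (T : Fin l → ι → α) (A : Fin m → ι → α) (t : ι)
    (r : Fin (l + m)) : Fin.append T A r t = Fin.append (fun i => T i t) (fun j => A j t) r := by
  refine Fin.addCases (fun r => ?_) (fun r => ?_) r <;> simp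

variable {V : Type*} [AddCommGroup V] [Module ℝ V] {l m : ℕ}

/-- An alternating form with its last arguments fixed. -/
def restrictLeft (c : V [⋀^Fin (l + m)]→ₗ[ℝ] ℂ) (A : Fin m → V) : V [⋀^Fin l]→ₗ[ℝ] ℂ where
  toFun T := c (Fin.append T A)
  map_update_add' T i x y := by
    have : ‹DecidableEq (Fin l)› = instDecidableEqFin l := Subsingleton.elim _ _
    subst this
    simp only [append_update_left]
    exact c.map_update_add _ _ _ _
  map_update_smul' T i r x := by
    have : ‹DecidableEq (Fin l)› = instDecidableEqFin l := Subsingleton.elim _ _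
    subst this
    simp only [append_update_left]
    exact c.map_update_smul _ _ _ _
  map_eq_zero_of_eq' T i j h hij :=
    c.map_eq_zero_of_eq _ (i := Fin.castAdd m i) (j := Fin.castAdd m j) (by simpa using h)
      (by simpa using hij)

/-- An alternating form with its first arguments fixed. -/
def restrictRight (c : V [⋀^Fin (l + m)]→ₗ[ℝ] ℂ) (T : Fin l → V) : V [⋀^Fin m]→ₗ[ℝ] ℂ where
  toFun A := c (Fin.append T A)
  map_update_add' A i x y := by
    have : ‹DecidableEq (Fin m)› = instDecidableEqFin m := Subsingleton.elim _ _
    subst this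
    simp only [append_update_right]
    exact c.map_update_add _ _ _ _
  map_update_smul' A i r x := by
    have : ‹DecidableEq (Fin m)› = instDecidableEqFin m := Subsingleton.elim _ _
    subst this
    simp only [append_update_right]
    exact c.map_update_smul _ _ _ _
  map_eq_zero_of_eq' A i j h hij :=
    c.map_eq_zero_of_eq _ (i := Fin.natAdd l i) (j := Fin.natAdd l j) (by simpa using h)
      (by simpa using hij)

end AppendUpdate

/-! ### Global extensions and faces of singular simplices -/

section Simplices

open MeasureTheory

variable {n : ℕ} {M : Type*} [TopologicalSpace M] [ChartedSpace (Rn n) M]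

theorem SmoothSimplex.param_of_mem {l : ℕ} (s : SmoothSimplex n M l) {t : Fin l → ℝ}
    (ht : t ∈ solidSimplex l) : s.param t = s.toFun ⟨simplexParam l t, ht⟩ :=
  dif_pos ht

/-- `F` is a smooth map on the whole of `ℝ^l` which extends the smooth singular simplex `s`. -/
structure SmoothSimplex.IsExtension {l : ℕ} (s : SmoothSimplex n M l) (F : (Fin l → ℝ) → M) :
    Prop where
  contMDiff : ContMDiff 𝓘(ℝ, Fin l → ℝ) (𝓡 n) ∞ F
  eq_param : ∀ t ∈ solidSimplex l, F t = s.param t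

/-- The given extension f lives only near the simplex, so it is precomposed with t ↦ χ(t)t for a
cut-off χ equal to 1 on the simplex. The image stays in a thickening of the simplex, which is convex
and contains 0. A globally defined map removes one-sided derivatives from everything that follows.
-/
theorem SmoothSimplex.exists_isExtension {l : ℕ} (s : SmoothSimplex n M l) :
    ∃ F, s.IsExtension F := by
  obtain ⟨U, f, hU, hsU, hf, hfs⟩ := s.smooth
  have hU' : IsOpen (simplexParam l ⁻¹' U) := hU.preimage (contDiff_simplexParam l).continuous
  obtain ⟨ε, hε, hεU⟩ := (isCompact_solidSimplex l).exists_thickening_subset_open hU'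
    (fun t ht => hsU ht)
  set N := Metric.thickening ε (solidSimplex l)
  have hKN : solidSimplex l ⊆ N := Metric.self_subset_thickening hε _
  obtain ⟨χ, hχ0, hχ1, hχ⟩ := exists_contMDiffMap_zero_one_of_isClosed
    (n := ⊤) 𝓘(ℝ, Fin l → ℝ) (Metric.isOpen_thickening (δ := ε) (E := solidSimplex l)).isClosed_compl
    (isClosed_solidSimplex l) (Set.disjoint_compl_left_iff_subset.2 hKN)
  have hχs : ContDiff ℝ ∞ χ := χ.contMDiff.contDiff
  have hN : ∀ t, χ t • t ∈ N := by
    intro t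
    by_cases ht : t ∈ N
    · have := ((convex_solidSimplex l).thickening ε) ht (hKN (zero_mem_solidSimplex l))
        (hχ t).1 (sub_nonneg.2 (hχ t).2) (by ring)
      simpa using this
    · have : χ t = 0 := hχ0 ht
      rw [this, zero_smul]
      exact hKN (zero_mem_solidSimplex l)
  refine ⟨fun t => f (simplexParam l (χ t • t)), ?_, fun t ht => ?_⟩
  · have h1 : ContMDiff 𝓘(ℝ, Fin l → ℝ) 𝓘(ℝ, Fin (l + 1) → ℝ) ∞
        fun t => simplexParam l (χ t • t) :=
      ((contDiff_simplexParam l).comp (hχs.smul contDiff_id)).contMDiff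
    rw [← contMDiffOn_univ] at h1 ⊢
    exact hf.comp h1 fun t _ => hεU (hN t)
  · have : χ t = 1 := hχ1 ht
    rw [s.param_of_mem ht, ← hfs]
    simp only [this, one_smul]

/-- Tangent vectors at different base points are compared as elements of `Rn n`, which avoids
transport along the equality of the base points. -/
theorem form_congr {l : ℕ} (θ : (x : M) → (Fin l → TangentSpace (𝓡 n) x) → ℂ) {x y : M}
    (hxy : x = y) {v w : Fin l → Rn n} (hvw : v = w) : θ x v = θ y w := by
  subst hxy; subst hvw; rfl

/-- The solid simplex has unique derivatives, even at boundary points, so the derivative within it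
is that of any extension. -/
theorem SmoothSimplex.IsExtension.integral_eq {l : ℕ} {s : SmoothSimplex n M l}
    {F : (Fin l → ℝ) → M} (hF : s.IsExtension F)
    (θ : (x : M) → (Fin l → TangentSpace (𝓡 n) x) → ℂ) :
    s.integral θ = ∫ t in solidSimplex l, θ (F t) (fun i =>
      mfderiv 𝓘(ℝ, Fin l → ℝ) (𝓡 n) F t (Pi.single i (1 : ℝ) : Fin l → ℝ)) := by
  refine setIntegral_congr_fun (measurableSet_solidSimplex l) fun t ht => ?_
  refine form_congr θ (hF.eq_param t ht).symm ?_
  funext i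
  have hu : UniqueMDiffWithinAt 𝓘(ℝ, Fin l → ℝ) (solidSimplex l) t :=
    (uniqueDiffOn_solidSimplex l t ht).uniqueMDiffWithinAt
  have h1 : HasMFDerivWithinAt 𝓘(ℝ, Fin l → ℝ) (𝓡 n) s.param (solidSimplex l) t
      (mfderiv 𝓘(ℝ, Fin l → ℝ) (𝓡 n) F t) :=
    ((hF.contMDiff.mdifferentiableAt (x := t) (by simp)).hasMFDerivAt.hasMFDerivWithinAt).congr_of_eventuallyEq
      (Filter.eventually_of_mem self_mem_nhdsWithin fun t ht => (hF.eq_param t ht).symm)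
      (hF.eq_param t ht).symm
  exact DFunLike.congr_fun (h1.mfderivWithin hu) (Pi.single i (1 : ℝ) : Fin l → ℝ)

theorem stdSimplex_map_succAbove {l : ℕ} (i : Fin (l + 2)) (t : stdSimplex ℝ (Fin (l + 1))) :
    (stdSimplex.map i.succAbove t : stdSimplex ℝ (Fin (l + 2))).1 = i.insertNth 0 t.1 := by
  funext k
  change FunOnFinite.linearMap ℝ ℝ i.succAbove t.1 k = _
  rw [FunOnFinite.linearMap_apply_apply]
  refine Fin.succAboveCases i ?_ (fun k => ?_) k
  · simp [Fin.succAbove_ne]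
  · simp [Finset.filter_eq']

theorem faceMap_mem {p : ℕ} (i : Fin (p + 2)) {t : Fin p → ℝ} (ht : t ∈ solidSimplex p) :
    faceMap i t ∈ solidSimplex (p + 1) := by
  have h := (stdSimplex.map i.succAbove (⟨_, ht⟩ : stdSimplex ℝ (Fin (p + 1)))).2
  change simplexParam (p + 1) (faceMap i t) ∈ stdSimplex ℝ (Fin (p + 2))
  rw [simplexParam_faceMap]
  rwa [stdSimplex_map_succAbove] at h

theorem SmoothSimplex.IsExtension.face {p : ℕ} {s : SmoothSimplex n M (p + 1)}
    {F : (Fin (p + 1) → ℝ) → M} (hF : s.IsExtension F) (i : Fin (p + 2)) :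
    (s.face i).IsExtension (F ∘ faceMap i) where
  contMDiff := hF.contMDiff.comp (contDiff_faceMap i).contMDiff
  eq_param t ht := by
    rw [Function.comp_apply, hF.eq_param _ (faceMap_mem i ht), param_of_mem _ ht,
      param_of_mem _ (faceMap_mem i ht)]
    refine congrArg s.toFun (Subtype.ext ?_)
    rw [stdSimplex_map_succAbove]
    exact simplexParam_faceMap i t

theorem Chain.integral_eq_linearCombination {l : ℕ} (σ : Chain n M l)
    (θ : (x : M) → (Fin l → TangentSpace (𝓡 n) x) → ℂ) :
    σ.integral θ = Finsupp.linearCombination ℂ (fun s : SmoothSimplex n M l => s.integral θ) σ :=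
  rfl

theorem Chain.integral_boundary {l : ℕ} (γ : Chain n M (l + 1))
    (θ : (x : M) → (Fin l → TangentSpace (𝓡 n) x) → ℂ) :
    Chain.integral (boundary γ) θ =
      γ.sum fun s a => a * ∑ i : Fin (l + 2), (-1 : ℂ) ^ (i : ℕ) * (s.face i).integral θ := by
  have h : boundary γ = γ.sum fun s a =>
      a • ∑ i : Fin (l + 2), (-1 : ℂ) ^ (i : ℕ) • Finsupp.single (s.face i) (1 : ℂ) := rfl
  rw [Chain.integral_eq_linearCombination, h, map_finsuppSum]
  refine Finsupp.sum_congr fun s _ => ?_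
  simp [Finsupp.linearCombination_single]

end Simplices

open MeasureTheory

/-! ### Continuity of cochains along smooth families -/

section CochainFamilies

variable {n : ℕ} {P : Type} [NormedAddCommGroup P] [NormedSpace ℝ P]

theorem IsSmoothFamily.lie {B B' : P → W n} (hB : IsSmoothFamily B) (hB' : IsSmoothFamily B') :
    IsSmoothFamily fun t => ⁅B t, B' t⁆ := by
  have h : ∀ {B B' : P → W n}, IsSmoothFamily B → IsSmoothFamily B' →
      ContDiff ℝ ∞ fun z : P × Rn n =>
        fderiv ℝ (fun z : P × Rn n => (B' z.1 z.2 : Rn n)) z (0, (B z.1 z.2 : Rn n)) :=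
    fun hB hB' => (ContDiff.fderiv_right (m := ∞) hB' (by simp)).clm_apply
      (contDiff_const.prodMk hB)
  refine (congrArg (fun f : P × Rn n → Rn n => ContDiff ℝ ∞ f) (funext fun z => ?_)).mpr
    (ContDiff.sub (h hB hB') (h hB' hB))
  refine (W.lie_apply _ _ _).trans (congrArg₂ (· - ·) ?_ ?_)
  · exact (CoordFamily.hasFDerivAt_inr_of_isSmoothFamily hB' z.1 z.2 _).symm
  · exact (CoordFamily.hasFDerivAt_inr_of_isSmoothFamily hB z.1 z.2 _).symm

theorem continuous_cochain {k : ℕ} (c : W n [⋀^Fin k]→L[ℝ] ℂ) {B : Fin k → P → W n}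
    (hB : ∀ i, IsSmoothFamily (B i)) : Continuous fun t => c (fun i => B i t) :=
  c.cont.comp (continuous_pi fun i => (hB i).continuous)

theorem continuous_cochain_cons {k : ℕ} (c : W n [⋀^Fin (k + 1)]→L[ℝ] ℂ)
    {B : Fin (k + 2) → P → W n} (hB : ∀ i, IsSmoothFamily (B i)) (i : Fin (k + 1))
    (j : Fin (k + 2)) : Continuous fun t => c (Fin.cons ⁅B i.castSucc t, B j t⁆
      (fun r : Fin k => B (j.succAbove (i.succAbove r)) t)) := by
  refine c.cont.comp (continuous_pi fun r => ?_)
  refine Fin.cases ?_ (fun r => ?_) r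
  · exact ((hB _).lie (hB _)).continuous
  · exact (hB _).continuous

theorem continuous_lieDTail {k : ℕ} (L : ℕ) (c : W n [⋀^Fin k]→L[ℝ] ℂ)
    {B : Fin (k + 1) → P → W n} (hB : ∀ i, IsSmoothFamily (B i)) :
    Continuous fun t => lieDTail L c (fun i => B i t) := by
  cases k with
  | zero => exact continuous_const
  | succ k =>
    refine continuous_finsetSum _ fun j _ => continuous_finsetSum _ fun i _ => ?_
    split_ifs
    · exact continuous_const.mul (continuous_cochain_cons c hB i j)
    · exact continuous_const
    · exact continuous_const

theorem lieDTail_zero {V : Type*} [LieRing V] [LieAlgebra ℝ V] {k : ℕ} (c : (Fin k → V) → ℂ)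
    (B : Fin (k + 1) → V) : lieDTail 0 c B = lieD c B := by
  cases k with
  | zero => rfl
  | succ k => simp [lieD, lieDTail]

theorem lieDTail_eq_zero {V : Type*} [LieRing V] [LieAlgebra ℝ V] {k : ℕ} {L : ℕ} (hL : k < L)
    (c : (Fin k → V) → ℂ) (B : Fin (k + 1) → V) : lieDTail L c B = 0 := by
  cases k with
  | zero => rfl
  | succ k =>
    refine Finset.sum_eq_zero fun j _ => Finset.sum_eq_zero fun i _ => ?_
    have := i.2
    rw [if_neg (by omega : ¬ L ≤ (i : ℕ)), ite_self]

theorem continuous_lieD {k : ℕ} (c : W n [⋀^Fin k]→L[ℝ] ℂ)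
    {B : Fin (k + 1) → P → W n} (hB : ∀ i, IsSmoothFamily (B i)) :
    Continuous fun t => lieD c (fun i => B i t) := by
  simpa only [lieDTail_zero] using continuous_lieDTail 0 c hB

theorem IsSmoothFamily.deriv_congr {B B' : P → W n} (h : B = B') (hB : IsSmoothFamily B)
    (hB' : IsSmoothFamily B') (e t : P) : hB.deriv e t = hB'.deriv e t := by
  subst h; rfl

end CochainFamilies

/-! ### Linearity and naturality of the Chevalley–Eilenberg differential -/

section LieD

variable {g : Type*} [LieRing g]

theorem lieD_sum {ι : Type*} (S : Finset ι) (a : ι → ℂ) {k : ℕ} (f : ι → (Fin k → g) → ℂ)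
    (A : Fin (k + 1) → g) :
    lieD (fun v => ∑ s ∈ S, a s * f s v) A = ∑ s ∈ S, a s * lieD (f s) A := by
  cases k with
  | zero => simp [lieD]
  | succ k =>
    simp only [lieD, Finset.mul_sum]
    refine Eq.trans (Finset.sum_congr rfl fun j _ => ?_) Finset.sum_comm
    refine Eq.trans ?_ Finset.sum_comm
    refine Finset.sum_congr rfl fun i _ => ?_
    split_ifs
    · refine Finset.sum_congr rfl fun s _ => ?_
      ring
    · simp

theorem lieD_const_mul (a : ℂ) {k : ℕ} (f : (Fin k → g) → ℂ) (A : Fin (k + 1) → g) :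
    lieD (fun v => a * f v) A = a * lieD f A := by
  simpa using lieD_sum {()} (fun _ => a) (fun _ => f) A

theorem lieD_comp {h : Type*} [LieRing h] {k : ℕ} (η : (Fin k → h) → ℂ)
    (F : g → h) (hF : ∀ x y, F ⁅x, y⁆ = ⁅F x, F y⁆) (A : Fin (k + 1) → g) :
    lieD (fun v : Fin k → g => η (fun i => F (v i))) A = lieD η (fun i => F (A i)) := by
  cases k with
  | zero => rfl
  | succ k =>
    refine Finset.sum_congr rfl fun j _ => Finset.sum_congr rfl fun i _ => ?_
    have h : (fun r => F ((Fin.cons ⁅A i.castSucc, A j⁆ (fun r : Fin k =>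
        A (j.succAbove (i.succAbove r))) : Fin (k + 1) → g) r)) =
        Fin.cons ⁅F (A i.castSucc), F (A j)⁆ (fun r : Fin k =>
          F (A (j.succAbove (i.succAbove r)))) := by
      funext r
      refine Fin.cases ?_ (fun r => ?_) r
      · exact hF _ _
      · rfl
    beta_reduce
    rw [h]

theorem lieD_setIntegral {X : Type*} [MeasurableSpace X] {μ : Measure X} {k : ℕ}
    (f : X → (Fin k → g) → ℂ) (hf : ∀ A, Integrable (fun x => f x A) μ) (A : Fin (k + 1) → g) :
    lieD (fun v => ∫ x, f x v ∂μ) A = ∫ x, lieD (f x) A ∂μ := by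
  cases k with
  | zero => simp [lieD]
  | succ k =>
    simp only [lieD]
    have hi : ∀ (j : Fin (k + 2)) (i : Fin (k + 1)), Integrable (fun x =>
        if i.castSucc < j then (-1 : ℂ) ^ ((i : ℕ) + (j : ℕ)) * f x (Fin.cons ⁅A i.castSucc, A j⁆
          (fun r : Fin k => A (j.succAbove (i.succAbove r)))) else 0) μ := by
      intro j i
      split_ifs
      · exact (hf _).const_mul _
      · exact integrable_zero _ _ _
    rw [integral_finsetSum _ fun j _ => integrable_finsetSum _ fun i _ => hi j i]
    refine Finset.sum_congr rfl fun j _ => ?_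
    rw [integral_finsetSum _ fun i _ => hi j i]
    refine Finset.sum_congr rfl fun i _ => ?_
    split_ifs
    · rw [integral_const_mul]
    · simp

theorem lieD_congr {k : ℕ} {f f' : (Fin k → g) → ℂ} (h : ∀ A, f A = f' A) (A : Fin (k + 1) → g) :
    lieD f A = lieD f' A := by
  rw [funext h]

end LieD

/-! ### Stokes' theorem for the canonical forms -/

section IntegralOfCochain

variable {n : ℕ} {M : Type*} [TopologicalSpace M] [ChartedSpace (Rn n) M]
  [IsManifold (𝓡 n) ∞ M] (φ : CoordFamily n M)

/-- The arguments of a cochain on `W n` in the definition of its integral over a simplex `F`, as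
families of vector fields on `ℝⁿ`. -/
def arguments {l m : ℕ} (F : (Fin l → ℝ) → M) (A : Fin m → Vect n M) :
    Fin (l + m) → (Fin l → ℝ) → W n :=
  Fin.append (fun i => φ.along F (Pi.single i 1)) (fun j t => φ.pull (F t) (A j))

theorem isSmoothFamily_arguments {l m : ℕ} {F : (Fin l → ℝ) → M}
    (hF : ContMDiff 𝓘(ℝ, Fin l → ℝ) (𝓡 n) ∞ F) (A : Fin m → Vect n M) (r : Fin (l + m)) :
    IsSmoothFamily (arguments φ F A r) := by
  refine Fin.addCases (fun r => ?_) (fun r => ?_) r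
  · rw [arguments, Fin.append_left]
    exact φ.isSmoothFamily_along hF _
  · rw [arguments, Fin.append_right]
    exact φ.isSmoothFamily_pull hF _

theorem integral_Theta_eq {l m : ℕ} {s : SmoothSimplex n M l} {F : (Fin l → ℝ) → M}
    (hF : s.IsExtension F) (ξ : (Fin (l + m) → W n) → ℂ) (A : Fin m → Vect n M) :
    s.integral (Theta φ ξ A) =
      ∫ t in solidSimplex l, ξ (fun r => arguments φ F A r t) := by
  rw [hF.integral_eq]
  congr 1
  funext t
  refine congrArg ξ (funext fun r => ?_)
  exact (append_apply (fun i => φ.along F (Pi.single i 1)) (fun j t => φ.pull (F t) (A j)) t r).symm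

/-- A vector field along a map `F` depends linearly on the tangent vector. -/
def CoordFamily.alongLM {P : Type} [NormedAddCommGroup P] [NormedSpace ℝ P] (F : P → M) (t : P) :
    P →ₗ[ℝ] W n :=
  (φ.tLM (F t)).comp (mfderiv 𝓘(ℝ, P) (𝓡 n) F t).toLinearMap

theorem along_comp_faceMap {p : ℕ} {F : (Fin (p + 1) → ℝ) → M}
    (hF : ContMDiff 𝓘(ℝ, Fin (p + 1) → ℝ) (𝓡 n) ∞ F) (i : Fin (p + 2)) (r : Fin p)
    (t : Fin p → ℝ) :
    φ.along (F ∘ faceMap i) (Pi.single r 1) t = φ.along F (faceVec i r) (faceMap i t) := by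
  have h := mfderiv_comp t (hF.mdifferentiableAt (x := faceMap i t) (by simp))
    ((contDiff_faceMap i).contMDiff.mdifferentiableAt (x := t) (by simp))
  refine congrArg (φ.t (F (faceMap i t))) ?_
  refine (DFunLike.congr_fun h (Pi.single r 1 : Fin p → ℝ)).trans ?_
  refine congrArg (mfderiv 𝓘(ℝ, Fin (p + 1) → ℝ) (𝓡 n) F (faceMap i t)) ?_
  rw [mfderiv_eq_fderiv]
  exact fderiv_faceMap i r t

/-- The exterior derivative of the form `Theta φ c A` on a simplex, in terms of the
Chevalley-Eilenberg differential of `c`. -/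
theorem sum_integral_face {p m : ℕ} (h : p + m + 1 = p + 1 + m) (c : W n [⋀^Fin (p + m)]→L[ℝ] ℂ)
    (A : Fin m → Vect n M) (s : SmoothSimplex n M (p + 1)) :
    ∑ i : Fin (p + 2), (-1 : ℂ) ^ (i : ℕ) * (s.face i).integral (Theta φ c A) =
      s.integral (Theta φ (fun v => lieDTail (p + 1) c (v ∘ Fin.cast h)) A) -
      s.integral (Theta φ (fun v => lieD c (v ∘ Fin.cast h)) A) := by
  obtain ⟨F, hF⟩ := s.exists_isExtension
  let B : Fin (p + m + 1) → (Fin (p + 1) → ℝ) → W n := fun r => arguments φ F A (Fin.cast h r)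
  have hB : ∀ r, IsSmoothFamily (B r) := fun r => isSmoothFamily_arguments φ hF.contMDiff A _
  let b : Fin (p + 1) → Fin (p + 1) → ℝ := fun r => Pi.single r 1
  let ι : Fin (p + 1) → Fin (p + m + 1) := fun j => Fin.cast h.symm (Fin.castAdd m j)
  have hBι : ∀ j, B (ι j) = φ.along F (b j) := fun j => Fin.append_left _ _ _
  have hBA : ∀ j, B (Fin.cast h.symm (Fin.natAdd (p + 1) j)) = fun t => φ.pull (F t) (A j) :=
    fun j => Fin.append_right _ _ _
  -- Row r holds the derivatives of all arguments in the r-th coordinate direction. The rows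
  -- belonging to the fields `A` are zero, as no direction corresponds to them.
  let E : (Fin (p + 1) → ℝ) → Fin (p + m + 1) → Fin (p + m + 1) → W n := fun t r r' =>
    if hr : (r : ℕ) < p + 1 then (hB r').deriv (b ⟨r, hr⟩) t else 0
  have hEι : ∀ t j r', E t (ι j) r' = (hB r').deriv (b j) t := fun t j r' => dif_pos j.2
  have hE : ∀ t (i j : Fin (p + m + 1)), i < j → (i : ℕ) < p + 1 →
      E t i j - E t j i = ⁅B i t, B j t⁆ := by
    -- Two tangent arguments give the Maurer–Cartan equation. A tangent argument and a field of `A`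
    -- give the Lie derivative formula, where the opposite entry of `E` is zero.
    intro t i j hij hi
    obtain ⟨i, rfl⟩ : ∃ i', i = ι i' := ⟨⟨i, hi⟩, rfl⟩
    by_cases hj : (j : ℕ) < p + 1
    · obtain ⟨j, rfl⟩ : ∃ j', j = ι j' := ⟨⟨j, hj⟩, rfl⟩
      rw [hEι, hEι, congrFun (hBι i) t, congrFun (hBι j) t,
        ← φ.deriv_along_sub_deriv_along hF.contMDiff,
        IsSmoothFamily.deriv_congr (hBι i) (hB _) (φ.isSmoothFamily_along hF.contMDiff _),
        IsSmoothFamily.deriv_congr (hBι j) (hB _) (φ.isSmoothFamily_along hF.contMDiff _)]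
    · have h0 : E t j (ι i) = 0 := dif_neg hj
      obtain ⟨j, rfl⟩ : ∃ j', j = Fin.cast h.symm (Fin.natAdd (p + 1) j') := by
        have := j.2
        exact ⟨⟨j - (p + 1), by omega⟩, by ext; simp; omega⟩
      rw [h0, sub_zero, hEι, congrFun (hBι i) t, congrFun (hBA j) t, ← φ.deriv_pull hF.contMDiff,
        IsSmoothFamily.deriv_congr (hBA j) (hB _) (φ.isSmoothFamily_pull hF.contMDiff _)]
  let g : Fin (p + 1) → (Fin (p + 1) → ℝ) → ℂ := fun j t =>
    ∑ i, c (Function.update (fun r => B ((ι j).succAbove r) t) i (E t (ι j) ((ι j).succAbove i)))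
  -- The pull-back of the canonical form by `F`, as an alternating form on the parameter space;
  -- linearity comes from that of v ↦ t_v.
  let θ : (Fin (p + 1) → ℝ) → (Fin (p + 1) → ℝ) [⋀^Fin p]→ₗ[ℝ] ℂ := fun t =>
    (restrictLeft c.toAlternatingMap (fun j => φ.pull (F t) (A j))).compLinearMap (φ.alongLM F t)
  have hθ : ∀ t (v : Fin p → Fin (p + 1) → ℝ), θ t v =
      c (Fin.append (fun r => φ.along F (v r) t) (fun j => φ.pull (F t) (A j))) := fun t v => rfl
  have hθB : ∀ j t, θ t (fun r => Pi.single (j.succAbove r) 1) =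
      c (fun r => B ((ι j).succAbove r) t) := by
    intro j t
    rw [hθ]
    refine congrArg c ?_
    have h1 := append_comp_castAdd_succAbove (fun i => φ.along F (b i) t)
      (fun j => φ.pull (F t) (A j)) h rfl j
    refine h1.symm.trans (funext fun r => ?_)
    exact (append_apply (fun i => φ.along F (b i)) (fun j t => φ.pull (F t) (A j)) t _).symm
  have hgc : ∀ j, Continuous (g j) := by
    intro j
    refine continuous_finsetSum _ fun i _ => c.cont.comp (Continuous.update ?_ i ?_)
    · exact continuous_pi fun r => (hB _).continuous
    · simp only [hEι]
      exact ((hB _).isSmoothFamily_deriv _).continuous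
  have hst := stokes_solidSimplex θ g (fun j => by
      simp only [hθB]; exact continuous_cochain c fun r => hB _) hgc (fun j t => by
      simp only [hθB, g, hEι]
      exact hasDerivAt_cochain c (fun r => hB ((ι j).succAbove r)) t (b j))
  have hsum : ∀ t, ∑ j : Fin (p + 1), (-1 : ℂ) ^ (j : ℕ) * g j t =
      lieDTail (p + 1) c (fun r => B r t) - lieD c (fun r => B r t) := by
    intro t
    refine Eq.trans ?_ (sum_update_add_lieD (p + 1) c.toAlternatingMap (fun r => B r t) (E t) (hE t)
      (fun i j hi _ => dif_neg (by omega)))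
    -- Stokes sums over the `p + 1` directions only, the algebraic identity over all arguments; the
    -- additional terms involve zero rows of `E`.
    rw [← (finCongr h).symm.sum_comp]
    refine Eq.trans ?_ (Fin.sum_univ_add _).symm
    rw [Finset.sum_eq_zero (s := (Finset.univ : Finset (Fin m))), add_zero]
    · rfl
    · intro j _
      have h0 : ∀ r', E t ((finCongr h).symm (Fin.natAdd (p + 1) j)) r' = 0 :=
        fun r' => dif_neg (by simp; omega)
      simp only [h0, AlternatingMap.map_update_zero, Finset.sum_const_zero, mul_zero]
  have hface : ∀ i : Fin (p + 2), (s.face i).integral (Theta φ c A) =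
      ∫ t in solidSimplex p, θ (faceMap i t) (faceVec i) := by
    intro i
    rw [integral_Theta_eq φ (hF.face i)]
    congr 1
    funext t
    rw [hθ]
    refine congrArg c (funext fun r => ?_)
    rw [arguments, append_apply]
    simp only [along_comp_faceMap φ hF.contMDiff, Function.comp_apply]
  rw [integral_Theta_eq φ hF, integral_Theta_eq φ hF]
  simp only [hface]
  rw [hst]
  simp only [hsum]
  exact integral_sub (integrableOn_solidSimplex (continuous_lieDTail _ c hB))
    (integrableOn_solidSimplex (continuous_lieD c hB))

end IntegralOfCochain

/-! ### Parameter integrals over compact sets -/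

section Continuity

/-- Joint continuity gives uniform closeness of the integrands on `K`, which works for an arbitrary
space of parameters; dominated convergence would ask for countability of its neighbourhood filters.
-/
theorem continuous_setIntegral_of_isCompact {X P E : Type*} [TopologicalSpace X]
    [TopologicalSpace P] [T2Space P] [MeasurableSpace P] [BorelSpace P] {μ : Measure P}
    [IsFiniteMeasureOnCompacts μ] [NormedAddCommGroup E] [NormedSpace ℝ E]
    [SecondCountableTopology P]
    {K : Set P} (hK : IsCompact K) {f : X → P → E}
    (hf : Continuous fun q : X × P => f q.1 q.2) : Continuous fun x => ∫ t in K, f x t ∂μ := by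
  have hi : ∀ x, IntegrableOn (f x) K μ := fun x =>
    ((hf.comp (by fun_prop : Continuous fun t : P => (x, t))).continuousOn).integrableOn_compact hK
  refine continuous_iff_continuousAt.2 fun x => Metric.tendsto_nhds.2 fun ε hε => ?_
  -- The added 1 keeps the denominator positive when `K` is a null set.
  have hV : 0 < μ.real K + 1 := by positivity
  obtain ⟨v, hv, hvK⟩ := hK.mem_uniformity_of_prod (s := Set.univ) (q := x) (f := f)
    hf.continuousOn (Set.mem_univ _) (Metric.dist_mem_uniformity (div_pos hε hV))
  rw [nhdsWithin_univ] at hv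
  filter_upwards [hv] with y hy
  rw [dist_eq_norm, ← integral_sub (hi y) (hi x)]
  have hle := norm_setIntegral_le_of_norm_le_const (μ := μ) (C := ε / (μ.real K + 1))
    (f := fun t => f y t - f x t) hK.measure_lt_top fun t ht => by
      rw [← dist_eq_norm]; exact (hvK y hy t ht).le
  refine hle.trans_lt ?_
  rw [div_mul_eq_mul_div, div_lt_iff₀ hV]
  linarith [mul_lt_mul_of_pos_left (lt_add_one (μ.real K)) hε]

end Continuity

/-! ### Degree casts and operations on cochains -/

section Casts

variable {V : Type*} [LieRing V]

/-- The degrees `p + (m + 1)` and `p + 1 + m` are equal only propositionally. They occur together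
because an argument moves from the tangent block to the block of vector fields. -/
theorem lieDTail_comp_cast (L : ℕ) {k k' : ℕ} (e : k = k') (h : k + 1 = k' + 1)
    (c : (Fin k' → V) → ℂ) (w : Fin (k' + 1) → V) :
    lieDTail L (fun v : Fin k → V => c (v ∘ Fin.cast e.symm)) (w ∘ Fin.cast h) =
      lieDTail L c w := by
  subst e; rfl

theorem lieD_comp_cast {k k' : ℕ} (e : k = k') (h : k + 1 = k' + 1)
    (c : (Fin k' → V) → ℂ) (w : Fin (k' + 1) → V) :
    lieD (fun v : Fin k → V => c (v ∘ Fin.cast e.symm)) (w ∘ Fin.cast h) = lieD c w := by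
  subst e; rfl

end Casts

section Cochains

variable {g : Type*} [LieRing g] [LieAlgebra ℝ g] [TopologicalSpace g]

theorem IsCochain.comp_cast {k k' : ℕ} (e : k = k') {c : (Fin k' → g) → ℂ} (hc : IsCochain c) :
    IsCochain fun v : Fin k → g => c (v ∘ Fin.cast e.symm) := by
  subst e; exact hc

theorem IsCochain.const_mul {k : ℕ} (a : ℂ) {c : (Fin k → g) → ℂ} (hc : IsCochain c) :
    IsCochain fun v => a * c v := by
  obtain ⟨f, hf⟩ := hc
  exact ⟨a • f, fun A => by simp [hf]⟩

theorem IsCochain.add {k : ℕ} {c c' : (Fin k → g) → ℂ} (hc : IsCochain c) (hc' : IsCochain c') :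
    IsCochain fun v => c v + c' v := by
  obtain ⟨f, hf⟩ := hc
  obtain ⟨f', hf'⟩ := hc'
  exact ⟨f + f', fun A => by simp [hf, hf']⟩

theorem isCochain_zero {k : ℕ} : IsCochain fun _ : Fin k → g => (0 : ℂ) :=
  ⟨0, fun _ => rfl⟩

theorem IsCochain.sum {ι : Type*} (S : Finset ι) {k : ℕ} {c : ι → (Fin k → g) → ℂ}
    (hc : ∀ i, IsCochain (c i)) : IsCochain fun v => ∑ i ∈ S, c i v := by
  classical
  induction S using Finset.induction_on with
  | empty => simpa using isCochain_zero
  | insert i S hi ih => simpa only [Finset.sum_insert hi] using (hc i).add ih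

end Cochains

theorem isCochain_setIntegral {g P : Type*} [LieRing g] [LieAlgebra ℝ g] [TopologicalSpace g]
    [TopologicalSpace P] [T2Space P] [SecondCountableTopology P] [MeasurableSpace P] [BorelSpace P]
    {μ : Measure P} [IsFiniteMeasureOnCompacts μ] {K : Set P} (hK : IsCompact K) {m : ℕ}
    (f : P → g [⋀^Fin m]→ₗ[ℝ] ℂ) (hf : Continuous fun q : (Fin m → g) × P => f q.2 q.1) :
    IsCochain fun A => ∫ t in K, f t A ∂μ := by
  have hi : ∀ A, IntegrableOn (fun t => f t A) K μ := fun A =>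
    (hf.comp (Continuous.prodMk_right A)).continuousOn.integrableOn_compact hK
  refine ⟨{ toFun := fun A => ∫ t in K, f t A ∂μ
            map_update_add' := fun A i x y => ?_
            map_update_smul' := fun A i r x => ?_
            map_eq_zero_of_eq' := fun A i j h hij => ?_
            cont := continuous_setIntegral_of_isCompact (f := fun A t => f t A) hK hf },
    fun A => rfl⟩
  · simp only [AlternatingMap.map_update_add]
    exact integral_add (hi _) (hi _)
  · simp only [AlternatingMap.map_update_smul]
    exact integral_smul _ _
  · simp only [(f _).map_eq_zero_of_eq A h hij]
    exact integral_zero _ _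

/-! ### Integrals over chains, the boundary formula and its consequences -/

variable {n : ℕ} {M : Type*} [TopologicalSpace M] [ChartedSpace (Rn n) M]
  [IsManifold (𝓡 n) ∞ M] (φ : CoordFamily n M)

theorem arguments_apply {l m : ℕ} (F : (Fin l → ℝ) → M) (A : Fin m → Vect n M) (t : Fin l → ℝ) :
    (fun r => arguments φ F A r t) =
      Fin.append (fun i => φ.along F (Pi.single i 1) t) (fun j => φ.pull (F t) (A j)) :=
  funext fun r => append_apply (fun i => φ.along F (Pi.single i 1))
    (fun j t => φ.pull (F t) (A j)) t r

/-- Joint continuity in the fields and the parameter is what makes the integral over a simplex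
continuous in the fields, that is, a genuine cochain. -/
theorem continuous_append_pull {l m : ℕ} (c : W n [⋀^Fin (l + m)]→L[ℝ] ℂ) {F : (Fin l → ℝ) → M}
    (hF : ContMDiff 𝓘(ℝ, Fin l → ℝ) (𝓡 n) ∞ F) :
    Continuous fun q : (Fin m → Vect n M) × (Fin l → ℝ) =>
      c (Fin.append (fun i => φ.along F (Pi.single i 1) q.2) (fun j => φ.pull (F q.2) (q.1 j))) := by
  refine c.cont.comp (continuous_pi fun r => ?_)
  refine Fin.addCases (fun r => ?_) (fun r => ?_) r
  · simp only [Fin.append_left]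
    exact (φ.isSmoothFamily_along hF _).continuous.comp continuous_snd
  · simp only [Fin.append_right]
    exact (φ.continuous_pull hF).comp
      (continuous_snd.prodMk ((continuous_apply r).comp continuous_fst))

theorem isCochain_simplex_integral {l m : ℕ} (c : W n [⋀^Fin (l + m)]→L[ℝ] ℂ)
    (s : SmoothSimplex n M l) :
    IsCochain fun A : Fin m → Vect n M => s.integral (Theta φ c A) := by
  obtain ⟨F, hF⟩ := s.exists_isExtension
  let f : (Fin l → ℝ) → Vect n M [⋀^Fin m]→ₗ[ℝ] ℂ := fun t =>
    (restrictRight c.toAlternatingMap fun i => φ.along F (Pi.single i 1) t).compLinearMap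
      (φ.pullLM (F t))
  have hf : ∀ t A, f t A =
      c (Fin.append (fun i => φ.along F (Pi.single i 1) t) (fun j => φ.pull (F t) (A j))) :=
    fun _ _ => rfl
  have h := isCochain_setIntegral (μ := volume) (isCompact_solidSimplex l) f
    (by simpa only [hf] using continuous_append_pull φ c hF.contMDiff)
  have he : (fun A : Fin m → Vect n M => s.integral (Theta φ c A)) =
      fun A => ∫ t in solidSimplex l, f t A := by
    funext A
    rw [integral_Theta_eq φ hF c A]
    simp only [arguments_apply, hf]
  rw [he]
  exact h

theorem isCochain_integral {l m : ℕ} {c : (Fin (l + m) → W n) → ℂ} (hc : IsCochain c)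
    (σ : Chain n M l) : IsCochain (integral φ σ c) := by
  obtain ⟨c, h⟩ := hc
  obtain rfl := funext h
  exact IsCochain.sum _ fun s => (isCochain_simplex_integral φ c s).const_mul (σ s)

/-- For fixed t, pull-back is a Lie algebra homomorphism, so the differential on Vect(M) passes to
`W n`, where it is the tail of the differential of c. -/
theorem lieD_simplex_integral {l m : ℕ} (c : W n [⋀^Fin (l + m)]→L[ℝ] ℂ) (s : SmoothSimplex n M l)
    (A : Fin (m + 1) → Vect n M) :
    lieD (fun A : Fin m → Vect n M => s.integral (Theta φ c A)) A =
      (-1 : ℂ) ^ l * s.integral (Theta φ (m := m + 1) (fun v => lieDTail l c v) A) := by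
  obtain ⟨F, hF⟩ := s.exists_isExtension
  have hi : ∀ A : Fin m → Vect n M, IntegrableOn (fun t => c (Fin.append
      (fun i => φ.along F (Pi.single i 1) t) (fun j => φ.pull (F t) (A j)))) (solidSimplex l) :=
    fun A => integrableOn_solidSimplex (by
      simpa only [arguments_apply] using
        continuous_cochain c fun r => isSmoothFamily_arguments φ hF.contMDiff A r)
  rw [lieD_congr fun A => integral_Theta_eq φ hF c A, integral_Theta_eq φ hF]
  simp only [arguments_apply]
  rw [lieD_setIntegral _ hi, ← integral_const_mul]
  refine congrArg _ (funext fun t => ?_)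
  refine (lieD_comp (fun v => c (Fin.append (fun i => φ.along F (Pi.single i 1) t) v))
    (φ.pull (F t)) (φ.pull_lie (F t)) A).trans ?_
  have h := lieDTail_append c.toAlternatingMap (fun i => φ.along F (Pi.single i 1) t)
    (fun j => φ.pull (F t) (A j))
  refine Eq.trans ?_ (congrArg ((-1 : ℂ) ^ l * ·) h.symm)
  rw [← mul_assoc, ← pow_add, Even.neg_one_pow ⟨l, rfl⟩, one_mul]
  rfl

/-- The Chevalley-Eilenberg differential of the integral of a cochain. -/
theorem lieD_integral {l m : ℕ} (c : W n [⋀^Fin (l + m)]→L[ℝ] ℂ) (σ : Chain n M l)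
    (A : Fin (m + 1) → Vect n M) :
    lieD (integral φ σ c) A =
      (-1 : ℂ) ^ l * integral φ (m := m + 1) σ (fun v => lieDTail l c v) A := by
  refine (lieD_sum σ.support σ (fun s (A : Fin m → Vect n M) => s.integral (Theta φ c A)) A).trans ?_
  refine Eq.trans ?_ (Finset.mul_sum _ _ _).symm
  refine Finset.sum_congr rfl fun s _ => ?_
  rw [lieD_simplex_integral]
  ring

theorem integral_boundary {p m : ℕ} (h : p + m + 1 = p + 1 + m) (c : W n [⋀^Fin (p + m)]→L[ℝ] ℂ)
    (γ : Chain n M (p + 1)) (A : Fin m → Vect n M) :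
    integral φ (boundary γ) c A =
      integral φ γ (fun v => lieDTail (p + 1) c (v ∘ Fin.cast h)) A -
      integral φ γ (fun v => lieD c (v ∘ Fin.cast h)) A := by
  refine (Chain.integral_boundary γ _).trans ?_
  refine Eq.trans (Finset.sum_congr rfl fun s _ => ?_) (Finset.sum_sub_distrib _ _)
  beta_reduce
  rw [sum_integral_face φ h, mul_sub]

theorem integral_eq_zero {l m : ℕ} (σ : Chain n M l) {ξ : (Fin (l + m) → W n) → ℂ}
    (hξ : ∀ v, ξ v = 0) (A : Fin m → Vect n M) : integral φ σ ξ A = 0 := by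
  refine Finset.sum_eq_zero fun s _ => ?_
  simp [SmoothSimplex.integral, Theta, hξ]

/-- The integral of a cochain over a boundary, evaluated on the empty family of vector fields. -/
theorem integral_boundary_zero {p : ℕ} (c : W n [⋀^Fin p]→L[ℝ] ℂ) (γ : Chain n M (p + 1))
    (A : Fin 0 → Vect n M) :
    integral φ (m := 0) (boundary γ) c A = - integral φ (m := 0) γ (fun v => lieD c v) A := by
  refine (integral_boundary φ (m := 0) rfl c γ A).trans ?_
  -- There are `p + 1` tangent arguments and nothing else, so the tail is empty.
  rw [integral_eq_zero φ γ (fun v => lieDTail_eq_zero (Nat.lt_succ_self p) _ _), zero_sub]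
  rfl

/-- The integral of a cochain over a boundary, in terms of the Chevalley-Eilenberg differential. -/
theorem integral_boundary_succ {p m : ℕ} (e : p + (m + 1) = p + 1 + m)
    {c : (Fin (p + 1 + m) → W n) → ℂ} (hc : IsCochain c)
    (γ : Chain n M (p + 1)) (A : Fin (m + 1) → Vect n M) :
    integral φ (boundary γ) (fun v : Fin (p + (m + 1)) → W n => c (v ∘ Fin.cast e.symm)) A =
      (-1 : ℂ) ^ (p + 1) * lieD (integral φ γ c) A -
        integral φ (m := m + 1) γ (fun v => lieD c v) A := by
  obtain ⟨f, hf⟩ := hc.comp_cast e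
  have hf' := funext hf
  obtain ⟨c', hc'⟩ := hc
  obtain rfl := funext hc'
  -- The differential on Vect(M) is rewritten as a tail; the two signs (−1)^{p+1} cancel and
  -- `integral_boundary` remains, up to casts.
  rw [lieD_integral, ← mul_assoc, ← pow_add, Even.neg_one_pow ⟨p + 1, rfl⟩, one_mul, hf']
  refine (integral_boundary φ (congrArg Nat.succ e) f γ A).trans ?_
  rw [← hf']
  exact congrArg₂ (fun a b => integral φ (m := m + 1) γ a A - integral φ (m := m + 1) γ b A)
    (funext fun v => lieDTail_comp_cast (p + 1) e _ c' v)
    (funext fun v => lieD_comp_cast e _ c' v)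

theorem integral_zero_chain {l m : ℕ} (ξ : (Fin (l + m) → W n) → ℂ) (A : Fin m → Vect n M) :
    integral φ (0 : Chain n M l) ξ A = 0 := by
  simp [integral, Chain.integral]

/-- For l > 0 the left-hand side of the boundary formula vanishes. For l = 0 no tangent arguments
are present and the tail is already the whole differential. -/
theorem lieD_integral_eq_of_isCycle {l m : ℕ} {c : (Fin (l + m) → W n) → ℂ} (hc : IsCochain c)
    {σ : Chain n M l} (hσ : IsCycle σ) (A : Fin (m + 1) → Vect n M) :
    lieD (integral φ σ c) A =
      (-1 : ℂ) ^ l * integral φ (m := m + 1) σ (fun v => lieD c v) A := by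
  cases l with
  | zero =>
    obtain ⟨c', hc'⟩ := hc
    obtain rfl := funext hc'
    rw [lieD_integral]
    simp only [lieDTail_zero]
  | succ p =>
    have h := integral_boundary_succ φ (by omega) hc σ A
    rw [show boundary σ = 0 from hσ, integral_zero_chain, eq_comm, sub_eq_zero] at h
    rw [← h, ← mul_assoc, ← pow_add, Even.neg_one_pow ⟨p + 1, rfl⟩, one_mul]

theorem isCocycle_integral {l m : ℕ} {ξ : (Fin (l + m) → W n) → ℂ} (hξ : IsCocycle ξ)
    {σ : Chain n M l} (hσ : IsCycle σ) : IsCocycle (integral φ σ ξ) := by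
  refine ⟨isCochain_integral φ hξ.1 σ, fun A => ?_⟩
  rw [lieD_integral_eq_of_isCycle φ hξ.1 hσ, integral_eq_zero φ σ hξ.2, mul_zero]

/-- If ξ = δη, a primitive is (−1)^l ∫_σ η. For m = 0 the integral has to vanish outright, and it
does: it equals −∫_{∂σ} η = 0 if l > 0, and ξ itself is 0 if l = 0. -/
theorem isCoboundary_integral {l m : ℕ} {ξ : (Fin (l + m) → W n) → ℂ} (hξ : IsCoboundary ξ)
    {σ : Chain n M l} (hσ : IsCycle σ) : IsCoboundary (integral φ σ ξ) := by
  cases m with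
  | zero =>
    intro A
    cases l with
    | zero => exact integral_eq_zero φ σ (show ∀ v, ξ v = 0 from hξ) A
    | succ p =>
      obtain ⟨η, ⟨c, hc⟩, h⟩ := hξ
      obtain rfl := funext hc
      have h0 := integral_boundary_zero φ c σ A
      rw [show boundary σ = 0 from hσ, integral_zero_chain, eq_comm, neg_eq_zero] at h0
      rwa [show ξ = fun v => lieD c v from funext h]
  | succ m =>
    obtain ⟨η, hη, h⟩ := hξ
    refine ⟨fun v => (-1 : ℂ) ^ l * integral φ (m := m) σ η v,
      (isCochain_integral φ (m := m) hη σ).const_mul _, fun A => ?_⟩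
    rw [lieD_const_mul, lieD_integral_eq_of_isCycle φ hη hσ, ← mul_assoc, ← pow_add,
      Even.neg_one_pow ⟨l, rfl⟩, one_mul, show ξ = fun v => lieD η v from funext h]
    rfl

/-- The term ∫_γ δξ of the boundary formula vanishes, so (−1)^{l+1} ∫_γ ξ is a primitive. For m = 0
that term is the whole formula and the integral is zero. -/
theorem isCoboundary_integral_boundary {l m : ℕ} {ξ : (Fin (l + m) → W n) → ℂ} (hξ : IsCocycle ξ)
    (γ : Chain n M (l + 1)) : IsCoboundary (integral φ (boundary γ) ξ) := by
  cases m with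
  | zero =>
    intro A
    obtain ⟨⟨c, hc⟩, h⟩ := hξ
    obtain rfl := funext hc
    exact (integral_boundary_zero φ c γ A).trans (by rw [integral_eq_zero φ γ h, neg_zero])
  | succ m =>
    have e : l + (m + 1) = l + 1 + m := by omega
    have hc := hξ.1.comp_cast e.symm
    refine ⟨fun v => (-1 : ℂ) ^ (l + 1) *
      integral φ γ (fun v : Fin (l + 1 + m) → W n => ξ (v ∘ Fin.cast e)) v,
      (isCochain_integral φ hc γ).const_mul _, fun A => ?_⟩
    have h := integral_boundary_succ φ e hc γ A
    rw [integral_eq_zero φ γ, sub_zero] at h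
    · rw [lieD_const_mul]
      exact h
    · intro v
      refine (lieD_comp_cast e.symm (congrArg Nat.succ e.symm) ξ
        (v ∘ Fin.cast (congrArg Nat.succ e))).trans (hξ.2 _)

end GelfandFuks

end

theorem theorem2p3 (n l m : ℕ) (ξ : (Fin (l + m) → GelfandFuks.W n) → ℂ)
    (hξ : GelfandFuks.IsCocycle ξ)
    {M : Type*} [TopologicalSpace M] [T2Space M] [SecondCountableTopology M]
    [ChartedSpace (GelfandFuks.Rn n) M] [IsManifold (𝓡 n) ∞ M]
    (φ : GelfandFuks.CoordFamily n M) :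
    (∀ σ : GelfandFuks.Chain n M l, GelfandFuks.IsCycle σ →
      GelfandFuks.IsCocycle (GelfandFuks.integral φ σ ξ)) ∧
    (GelfandFuks.IsCoboundary ξ → ∀ σ : GelfandFuks.Chain n M l, GelfandFuks.IsCycle σ →
      GelfandFuks.IsCoboundary (GelfandFuks.integral φ σ ξ)) ∧
    (∀ σ : GelfandFuks.Chain n M l, GelfandFuks.IsBoundary σ →
      GelfandFuks.IsCoboundary (GelfandFuks.integral φ σ ξ)) := by
  refine ⟨fun σ hσ => GelfandFuks.isCocycle_integral φ hξ hσ,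
    fun h σ hσ => GelfandFuks.isCoboundary_integral φ h hσ, ?_⟩
  rintro _ ⟨γ, rfl⟩
  exact GelfandFuks.isCoboundary_integral_boundary φ hξ γ
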